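/- Let $d\ge 2$, $\alpha=\frac{2}{d-1}$, let $q\in\mathbb S^{d-1}\subset\mathbb R^d$ be fixed and let $V\in\mathbb R^{d\times d}$. For every $n$ let $x_1,\dots,x_n$ be i.i.d. random points of $\mathbb S^{d-1}$ with common law $\rho\,d\sigma$, where $\sigma$ is the (unnormalized) surface measure and the density $\rho\ge 0$ is of class $C^2$ with $\rho(q)>0$. For $\beta_n\in\mathbb R$ put $$A_j=\frac{e^{\beta_n\langle q,x_j\rangle}}{\sum_{l=1}^n e^{\beta_n\langle q,x_l\rangle}},\qquad \mathsf{ATT}(n)=V\sum_{j=1}^n A_jx_j,\qquad \mathcal Y_n(q)=\mathsf{ATT}(n)-Vq .$$ Assume $\beta_n n^{-\alpha}\to\gamma\in(0,\infty)$. Let $\mathbb S_q^{d-2}=\{\theta\in\mathbb R^d:\langle\theta,q\rangle=0,\ \|\theta\|=1\}$, let $\nu_q$ be the uniform probability measure on it, let $\sigma_{d-2}$ be the surface area of $\mathbb S^{d-2}$ (with $\sigma_0=2$), and let $$C(q)=\frac{2^{1/\alpha}\sigma_{d-2}}{d-1}\,\rho(q).$$ Then $C(q)=\lim_{t\to0^+}t^{-1/\alpha}\,\mathbb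 P(1-\langle q,x_1\rangle\le t)$. There exists a Poisson point process $\mathcal M_\gamma$ on $[0,\infty)\times\mathbb S_q^{d-2}$ with intensity measure $$\Lambda_\gamma(dy,d\theta)=\frac{C(q)}{\alpha\gamma^{1/\alpha}}\,y^{1/\alpha-1}\,dy\,\nu_q(d\theta),$$ and for every such process, almost surely, the two integrals in $$\Xi=\frac{\int e^{-y}\sqrt{2y}\,\theta\,\mathcal M_\gamma(dy,d\theta)}{\int e^{-y}\,\mathcal M_\gamma(dy,d\theta)}$$ converge absolutely and the denominator is positive, and as $n\to\infty$ $$\sqrt{\beta_n}\,\mathcal Y_n(q)\longrightarrow V\Xi\quad\text{in distribution.}$$ In particular $\mathcal Y_n(q)\to0$ in probability, and hence $\mathsf{ATT}(n)\to Vq$ in probability. -/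

import Mathlib

open MeasureTheory ProbabilityTheory Filter Topology Metric
open scoped NNReal ENNReal Manifold RealInnerProductSpace

noncomputable section

/-- The surface measure on the unit sphere of a finite-dimensional Euclidean space `F`
(counting measure on the two unit vectors if `F` is a line). -/
def surfaceMeasure (F : Type*) [NormedAddCommGroup F] [InnerProductSpace ℝ F]
    [FiniteDimensional ℝ F] [MeasurableSpace F] [BorelSpace F] : Measure (sphere (0 : F) 1) :=
  (measureSpaceOfInnerProductSpace (E := F)).volume.toSphere

/-- The unit sphere `S^{d-1}` of `ℝ^d`. -/
abbrev USphere (d : ℕ) : Type := sphere (0 : EuclideanSpace ℝ (Fin d)) 1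

/-- The tangent space `T_q S^{d-1}`, i.e. the orthogonal complement of `q` in `ℝ^d`. -/
abbrev tangentAt {d : ℕ} (q : USphere d) : Submodule ℝ (EuclideanSpace ℝ (Fin d)) :=
  (Submodule.span ℝ {(q : EuclideanSpace ℝ (Fin d))})ᗮ

/-- The unit sphere `S_q^{d-2}` of the tangent space at `q`. -/
abbrev TangentSphere {d : ℕ} (q : USphere d) : Type := sphere (0 : tangentAt q) 1

/-- The uniform probability measure on the tangent unit sphere. -/
def uniformTangent {d : ℕ} (q : USphere d) : Measure (TangentSphere q) :=
  (surfaceMeasure (tangentAt q) Set.univ)⁻¹ • surfaceMeasure (tangentAt q)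

/-- `ρ` is a function of class `C²` on the manifold `S^{d-1}`. -/
def IsC2OnSphere (d : ℕ) (hd : 2 ≤ d) (ρ : USphere d → ℝ) : Prop :=
  haveI : Fact (Module.finrank ℝ (EuclideanSpace ℝ (Fin d)) = (d - 1) + 1) :=
    ⟨by rw [finrank_euclideanSpace_fin]; omega⟩
  ContMDiff (𝓡 (d - 1)) 𝓘(ℝ, ℝ) 2 ρ

/-- The measure `ρ dσ` on the sphere. -/
def densityLaw {d : ℕ} (ρ : USphere d → ℝ) : Measure (USphere d) :=
  (surfaceMeasure (EuclideanSpace ℝ (Fin d))).withDensity fun x => ENNReal.ofReal (ρ x)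

/-- The exponent `α = 2 / (d - 1)`. -/
def alphaExp (d : ℕ) : ℝ := 2 / ((d : ℝ) - 1)

/-- The distance-to-query `1 - ⟨q, x⟩`. -/
def distToQuery {d : ℕ} (q x : USphere d) : ℝ :=
  1 - ⟪(q : EuclideanSpace ℝ (Fin d)), (x : EuclideanSpace ℝ (Fin d))⟫

/-- The softmax attention weight of the `j`-th of the keys `x`. -/
def attnWeight {d n : ℕ} (β : ℝ) (q : USphere d) (x : Fin n → USphere d) (j : Fin n) : ℝ :=
  Real.exp (β * ⟪(q : EuclideanSpace ℝ (Fin d)), (x j : EuclideanSpace ℝ (Fin d))⟫) /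
    ∑ l, Real.exp (β * ⟪(q : EuclideanSpace ℝ (Fin d)), (x l : EuclideanSpace ℝ (Fin d))⟫)

/-- The attention output `V ∑ⱼ Aⱼ xⱼ`. -/
def attnOutput {d n : ℕ} (V : Matrix (Fin d) (Fin d) ℝ) (β : ℝ) (q : USphere d)
    (x : Fin n → USphere d) : EuclideanSpace ℝ (Fin d) :=
  V.toEuclideanLin (∑ j, attnWeight β q x j • (x j : EuclideanSpace ℝ (Fin d)))

/-- The displacement `V ∑ⱼ Aⱼ xⱼ - V q`. -/
def attnDisplacement {d n : ℕ} (V : Matrix (Fin d) (Fin d) ℝ) (β : ℝ) (q : USphere d)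
    (x : Fin n → USphere d) : EuclideanSpace ℝ (Fin d) :=
  attnOutput V β q x - V.toEuclideanLin (q : EuclideanSpace ℝ (Fin d))

/-- The local intensity `2^{1/α} σ_{d-2} ρ(q) / (d - 1)` of keys near the query, where `σ_{d-2}`
is the surface area of `S^{d-2}` and `r = ρ(q)`. -/
def localIntensity (d : ℕ) (r : ℝ) : ℝ :=
  2 ^ (1 / alphaExp d) * (surfaceMeasure (EuclideanSpace ℝ (Fin (d - 1)))).real Set.univ
    / ((d : ℝ) - 1) * r

/-- The measure `C / (α γ^{1/α}) y^{1/α - 1} dy ⊗ ν_q(dθ)` on `[0,∞) × S_q^{d-2}`, where `C` is the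
local intensity for `ρ(q) = r`. Its value on `[0,y] × B` is `C (y/γ)^{1/α} ν_q(B)`. -/
def criticalIntensity {d : ℕ} (q : USphere d) (γ r : ℝ) : Measure (ℝ≥0 × TangentSphere q) :=
  (((volume : Measure ℝ).comap ((↑) : ℝ≥0 → ℝ)).withDensity fun y => ENNReal.ofReal
    (localIntensity d r / (alphaExp d * γ ^ (1 / alphaExp d)) *
      (y : ℝ) ^ (1 / alphaExp d - 1))).prod (uniformTangent q)

/-- `M` is a Poisson point process on `X` with intensity measure `Λ`: a random boundedly finite
integer-valued measure whose value on a measurable set `B` of finite intensity is Poisson with mean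
`Λ B`, and whose values on disjoint measurable sets are independent. -/
structure IsPoissonPointProcess {X Ω : Type*} [PseudoMetricSpace X] [MeasurableSpace X]
    [MeasurableSpace Ω] (P : Measure Ω) (Λ : Measure X) (M : Ω → Measure X) : Prop where
  measurable : Measurable M
  counting : ∀ ω, ∀ B : Set X, MeasurableSet B → Bornology.IsBounded B →
    ∃ k : ℕ, M ω B = (k : ℝ≥0∞)
  hasLaw : ∀ B : Set X, MeasurableSet B → Λ B ≠ ∞ →
    HasLaw (fun ω => M ω B)
      ((poissonMeasure (Λ B).toNNReal).map fun k : ℕ => (k : ℝ≥0∞)) P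
  indep : ∀ (m : ℕ) (B : Fin m → Set X), (∀ i, MeasurableSet (B i)) →
    (Pairwise fun i j => Disjoint (B i) (B j)) → iIndepFun (fun i ω => M ω (B i)) P

/-- The integrand `e^{-y} √(2y) θ`, as a vector of `ℝ^d`. -/
def criticalNumer {d : ℕ} (q : USphere d) (z : ℝ≥0 × TangentSphere q) :
    EuclideanSpace ℝ (Fin d) :=
  (Real.exp (-(z.1 : ℝ)) * √(2 * (z.1 : ℝ))) • ((z.2 : tangentAt q) : EuclideanSpace ℝ (Fin d))

/-- The integrand `e^{-y}`. -/
def criticalDenom {d : ℕ} (q : USphere d) (z : ℝ≥0 × TangentSphere q) : ℝ :=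
  Real.exp (-(z.1 : ℝ))

/-- The functional `μ ↦ ∫ e^{-y} √(2y) θ dμ / ∫ e^{-y} dμ`. -/
def criticalRatio {d : ℕ} (q : USphere d) (μ : Measure (ℝ≥0 × TangentSphere q)) :
    EuclideanSpace ℝ (Fin d) :=
  (∫ z, criticalDenom q z ∂μ)⁻¹ • ∫ z, criticalNumer q z ∂μ

end

/-! Multiplying numerator and denominator of the softmax by `e ^ (-β)`, the rescaled displacement is
`V` applied to the ratio of the components of `∑ⱼ e ^ (-β Dⱼ) (√β (xⱼ - q), 1)`, where
`Dⱼ = 1 - ⟨q, xⱼ⟩`. This is a sum of i.i.d. vectors `kⱼ`, with characteristic function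
`(1 + ∫ (e ^ (i ⟨k, t⟩) - 1) ρ dσ) ^ n` at `t`. The integrand lives at distance `β ^ (-1/2)` from
`q`, so after blowing up the gnomonic chart at `q` by `√β`, and since
`n β ^ (-1/α) → γ ^ (-1/α)`, the integral times `n` converges to an integral over the tangent space.
In the polar coordinates `y = ‖v‖² / 2`, `θ = v / ‖v‖` this is the integral of `e ^ (i ⟨·, t⟩) - 1`
against `Λ_γ`, which is the exponent in the characteristic functional of the Poisson process. Lévy's
continuity theorem thus gives joint convergence of numerator and denominator, and as the limiting
denominator is almost surely positive the ratio converges by the continuous mapping theorem. -/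

noncomputable section

/-! ### Integrals with respect to a Poisson point process -/

section ExpMulI

lemma enorm_exp_mul_I_sub_exp_mul_I_le (a b : ℝ) :
    ‖Complex.exp (a * Complex.I) - Complex.exp (b * Complex.I)‖ₑ ≤ ‖a - b‖ₑ := by
  have hfactor : Complex.exp (a * Complex.I) - Complex.exp (b * Complex.I) =
      Complex.exp (b * Complex.I) * (Complex.exp (Complex.I * ((a - b : ℝ) : ℂ)) - 1) := by
    rw [mul_sub, ← Complex.exp_add]
    push_cast
    ring_nf
  rw [enorm_le_iff_norm_le, hfactor, norm_mul, Complex.norm_exp_ofReal_mul_I, one_mul]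
  exact Real.norm_exp_I_mul_ofReal_sub_one_le

variable {X : Type*} [MeasurableSpace X] {Λ : Measure X} {f : X → ℝ}

lemma integrable_exp_mul_I [IsFiniteMeasure Λ] (hf : AEStronglyMeasurable f Λ) :
    Integrable (fun x => Complex.exp (f x * Complex.I)) Λ := by
  refine .of_bound (C := 1) ?_ (ae_of_all _ fun x => (Complex.norm_exp_ofReal_mul_I _).le)
  exact (by fun_prop : Continuous fun a : ℝ => Complex.exp (a * Complex.I))
    |>.comp_aestronglyMeasurable hf

lemma integrable_exp_mul_I_sub_one (hf : Integrable f Λ) :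
    Integrable (fun x => Complex.exp (f x * Complex.I) - 1) Λ := by
  refine hf.mono ?_ (ae_of_all _ fun x => ?_)
  · exact (by fun_prop : Continuous fun a : ℝ => Complex.exp (a * Complex.I) - 1)
      |>.comp_aestronglyMeasurable hf.1
  · simpa [enorm_le_iff_norm_le] using enorm_exp_mul_I_sub_exp_mul_I_le (f x) 0

end ExpMulI

lemma lintegral_natCast_poissonMeasure (r : ℝ≥0) :
    ∫⁻ k : ℕ, (k : ℝ≥0∞) ∂(poissonMeasure r) = r := by
  have hshift (k : ℕ) : ((k + 1 : ℕ) : ℝ≥0∞) * poissonMeasure r {k + 1} =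
      r * poissonMeasure r {k} := by
    rw [poissonMeasure_singleton, poissonMeasure_singleton, ← ENNReal.ofReal_natCast,
      ← ENNReal.ofReal_coe_nnreal, ← ENNReal.ofReal_mul (by positivity),
      ← ENNReal.ofReal_mul (by positivity), Nat.factorial_succ]
    congr 1
    push_cast
    field_simp
    ring
  have hmass : ∑' k : ℕ, poissonMeasure r {k} = 1 := by
    simpa using (lintegral_countable' (μ := poissonMeasure r) fun _ => 1).symm
  rw [lintegral_countable', tsum_eq_zero_add' ENNReal.summable]
  simp only [hshift, ENNReal.tsum_mul_left, hmass, CharP.cast_eq_zero, zero_mul, zero_add, mul_one]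

namespace IsPoissonPointProcess

variable {X Ω : Type*} [PseudoMetricSpace X] [MeasurableSpace X] [MeasurableSpace Ω]
  {P : Measure Ω} {Λ : Measure X} {M : Ω → Measure X}

lemma measurable_apply (hM : IsPoissonPointProcess P Λ M) {B : Set X} (hB : MeasurableSet B) :
    Measurable fun ω => M ω B :=
  (Measure.measurable_coe hB).comp hM.measurable

section Campbell

lemma lintegral_apply (hM : IsPoissonPointProcess P Λ M) {B : Set X} (hB : MeasurableSet B)
    (hfin : Λ B ≠ ∞) : ∫⁻ ω, M ω B ∂P = Λ B := by
  rw [(hM.hasLaw B hB hfin).lintegral_comp (f := fun z => z) aemeasurable_id,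
    lintegral_map (f := fun z : ℝ≥0∞ => z) measurable_id (by fun_prop)]
  simp only [lintegral_natCast_poissonMeasure, ENNReal.coe_toNNReal hfin]

variable [SigmaFinite Λ]

lemma bind_eq (hM : IsPoissonPointProcess P Λ M) : P.bind M = Λ := by
  rw [Measure.ext_iff_of_iUnion_eq_univ (iUnion_spanningSets Λ)]
  intro i
  ext s hs
  have hsi : MeasurableSet (s ∩ spanningSets Λ i) := hs.inter (measurableSet_spanningSets Λ i)
  rw [Measure.restrict_apply hs, Measure.restrict_apply hs,
    Measure.bind_apply hsi hM.measurable.aemeasurable, hM.lintegral_apply hsi]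
  exact measure_ne_top_of_subset Set.inter_subset_right (measure_spanningSets_lt_top Λ i).ne

/-- **Campbell's formula** -/
lemma lintegral_lintegral (hM : IsPoissonPointProcess P Λ M) {f : X → ℝ≥0∞} (hf : Measurable f) :
    ∫⁻ ω, ∫⁻ x, f x ∂(M ω) ∂P = ∫⁻ x, f x ∂Λ := by
  rw [← Measure.lintegral_bind hM.measurable.aemeasurable hf.aemeasurable, hM.bind_eq]

variable {E : Type*} [NormedAddCommGroup E] {f : X → E}

lemma ae_integrable (hM : IsPoissonPointProcess P Λ M) (hf : StronglyMeasurable f)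
    (hi : Integrable f Λ) : ∀ᵐ ω ∂P, Integrable f (M ω) := by
  have hmean : ∫⁻ ω, ∫⁻ x, ‖f x‖ₑ ∂(M ω) ∂P ≠ ∞ := by
    rw [hM.lintegral_lintegral hf.enorm]
    exact hi.2.ne
  have hmeas : Measurable fun ω => ∫⁻ x, ‖f x‖ₑ ∂(M ω) :=
    (Measure.measurable_lintegral hf.enorm).comp hM.measurable
  filter_upwards [ae_lt_top hmeas hmean] with ω hω
  exact ⟨hf.aestronglyMeasurable, hω⟩

omit [SigmaFinite Λ] in
lemma stronglyMeasurable_integral [NormedSpace ℝ E] (hM : IsPoissonPointProcess P Λ M)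
    (hf : StronglyMeasurable f) : StronglyMeasurable fun ω => ∫ x, f x ∂(M ω) :=
  hf.integral_kernel (κ := ⟨M, hM.measurable⟩)

end Campbell

section CharacteristicFunctional

lemma integral_exp_toReal_apply_mul (hM : IsPoissonPointProcess P Λ M) {B : Set X}
    (hB : MeasurableSet B) (hfin : Λ B ≠ ∞) (t : ℝ) :
    ∫ ω, Complex.exp (((M ω B).toReal * t : ℝ) * Complex.I) ∂P =
      Complex.exp ((Λ.real B : ℂ) * (Complex.exp (t * Complex.I) - 1)) := by
  have hpoisson := charFun_map_cast_poissonMeasure (Λ B).toNNReal t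
  rw [charFun_apply, integral_map .of_discrete (by fun_prop)] at hpoisson
  simp_rw [Real.inner_apply] at hpoisson
  have htransfer := (hM.hasLaw B hB hfin).integral_comp
    (f := fun z : ℝ≥0∞ => Complex.exp ((z.toReal * t : ℝ) * Complex.I)) (by fun_prop)
  rw [integral_map (by fun_prop) (by fun_prop)] at htransfer
  simp only [ENNReal.toReal_natCast] at htransfer
  exact htransfer.trans hpoisson

lemma iIndepFun_apply (hM : IsPoissonPointProcess P Λ M) {ι : Type*} [Finite ι] {B : ι → Set X}
    (hB : ∀ i, MeasurableSet (B i)) (hd : Pairwise fun i j => Disjoint (B i) (B j)) :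
    iIndepFun (fun i ω => M ω (B i)) P := by
  let e := Finite.equivFin ι
  have h := hM.indep (Nat.card ι) (fun k => B (e.symm k)) (fun k => hB _)
    fun i j hij => hd (e.symm.injective.ne hij)
  simpa [e] using h.precomp e.injective

lemma integral_exp_sum_toReal_apply_mul (hM : IsPoissonPointProcess P Λ M) {ι : Type*} [Fintype ι]
    {B : ι → Set X} (hB : ∀ i, MeasurableSet (B i))
    (hd : Pairwise fun i j => Disjoint (B i) (B j)) (hfin : ∀ i, Λ (B i) ≠ ∞) (t : ι → ℝ) :
    ∫ ω, Complex.exp ((∑ i, (M ω (B i)).toReal * t i : ℝ) * Complex.I) ∂P =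
      Complex.exp (∑ i, (Λ.real (B i) : ℂ) * (Complex.exp (t i * Complex.I) - 1)) := by
  have hprod := ((hM.iIndepFun_apply hB hd).comp
    (fun i z => Complex.exp ((z.toReal * t i : ℝ) * Complex.I))
    (fun i => by fun_prop)).integral_fun_prod_eq_prod_integral fun i => by
      have := hM.measurable_apply (hB i)
      exact Measurable.aestronglyMeasurable (by fun_prop)
  simp only [Function.comp_def, hM.integral_exp_toReal_apply_mul (hB _) (hfin _),
    ← Complex.exp_sum, ← Finset.sum_mul, ← Complex.ofReal_sum] at hprod
  exact hprod

variable [SigmaFinite Λ]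

lemma integral_exp_integral_simpleFunc (hM : IsPoissonPointProcess P Λ M)
    (s : SimpleFunc X ℝ) (hi : Integrable s Λ) :
    ∫ ω, Complex.exp ((∫ x, s x ∂(M ω) : ℝ) * Complex.I) ∂P =
      Complex.exp (∫ x, (Complex.exp (s x * Complex.I) - 1) ∂Λ) := by
  let values : Finset ℝ := s.range.filter (· ≠ 0)
  have hne (y : values) : (y : ℝ) ≠ 0 := (Finset.mem_filter.1 y.2).2
  have hfin (y : values) : Λ (s ⁻¹' {(y : ℝ)}) ≠ ∞ :=
    (SimpleFunc.measure_preimage_lt_top_of_integrable s hi (hne y)).ne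
  have hexponent : ∫ x, (Complex.exp (s x * Complex.I) - 1) ∂Λ =
      ∑ y : values, (Λ.real (s ⁻¹' {(y : ℝ)}) : ℂ) * (Complex.exp ((y : ℝ) * Complex.I) - 1) := by
    have hmap := SimpleFunc.map_integral (μ := Λ) s
      (fun a : ℝ => Complex.exp (a * Complex.I) - 1) hi (by simp)
    rw [SimpleFunc.integral_eq_integral (s.map fun a : ℝ => Complex.exp (a * Complex.I) - 1)
      (integrable_exp_mul_I_sub_one hi)] at hmap
    simp only [SimpleFunc.coe_map, Function.comp_def, Complex.real_smul] at hmap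
    rw [hmap, Finset.sum_coe_sort values
      fun y => (Λ.real (s ⁻¹' {y}) : ℂ) * (Complex.exp (y * Complex.I) - 1),
      Finset.sum_filter_of_ne]
    rintro y - hy rfl
    simp at hy
  have hlinear : ∀ᵐ ω ∂P, ∫ x, s x ∂(M ω) =
      ∑ y : values, (M ω (s ⁻¹' {(y : ℝ)})).toReal * (y : ℝ) := by
    filter_upwards [hM.ae_integrable s.stronglyMeasurable hi] with ω hω
    rw [← SimpleFunc.integral_eq_integral _ hω, SimpleFunc.integral_eq_sum_filter,
      Finset.sum_coe_sort values fun y => (M ω (s ⁻¹' {y})).toReal * y]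
    rfl
  rw [hexponent, ← hM.integral_exp_sum_toReal_apply_mul (fun y => s.measurableSet_fiber _)
    (fun y z hyz => Disjoint.preimage _ (by simpa using fun h => hyz (Subtype.ext h))) hfin]
  refine integral_congr_ae ?_
  filter_upwards [hlinear] with ω hω
  rw [hω]

theorem integral_exp_integral [IsFiniteMeasure P] (hM : IsPoissonPointProcess P Λ M) {f : X → ℝ}
    (hf : Measurable f) (hi : Integrable f Λ) :
    ∫ ω, Complex.exp ((∫ x, f x ∂(M ω) : ℝ) * Complex.I) ∂P =
      Complex.exp (∫ x, (Complex.exp (f x * Complex.I) - 1) ∂Λ) := by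
  let s : ℕ → SimpleFunc X ℝ := SimpleFunc.approxOn f hf (Set.range f ∪ {0}) 0 (by simp)
  have hsi (n : ℕ) : Integrable (s n) Λ := SimpleFunc.integrable_approxOn_range hf hi n
  have hL1 : Tendsto (fun n => ∫⁻ x, ‖s n x - f x‖ₑ ∂Λ) atTop (𝓝 0) :=
    SimpleFunc.tendsto_approxOn_range_L1_enorm hf hi
  have hmeas {g : X → ℝ} (hg : Measurable g) :
      AEStronglyMeasurable (fun ω => ∫ x, g x ∂(M ω)) P :=
    (hM.stronglyMeasurable_integral hg.stronglyMeasurable).aestronglyMeasurable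
  have hleft : Tendsto (fun n => ∫ ω, Complex.exp ((∫ x, s n x ∂(M ω) : ℝ) * Complex.I) ∂P) atTop
      (𝓝 (∫ ω, Complex.exp ((∫ x, f x ∂(M ω) : ℝ) * Complex.I) ∂P)) := by
    refine tendsto_integral_of_L1 _ (integrable_exp_mul_I (hmeas hf)).1
      (.of_forall fun n => integrable_exp_mul_I (hmeas (s n).measurable))
      (tendsto_of_tendsto_of_tendsto_of_le_of_le tendsto_const_nhds hL1 (fun _ => bot_le)
        fun n => ?_)
    have hdist : Measurable fun x => ‖s n x - f x‖ₑ := ((s n).measurable.sub hf).enorm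
    rw [← hM.lintegral_lintegral hdist]
    refine lintegral_mono_ae ?_
    filter_upwards [hM.ae_integrable (s n).stronglyMeasurable (hsi n),
      hM.ae_integrable hf.stronglyMeasurable hi] with ω hsω hfω
    refine (enorm_exp_mul_I_sub_exp_mul_I_le _ _).trans ?_
    rw [← integral_sub hsω hfω]
    exact enorm_integral_le_lintegral_enorm _
  have hright : Tendsto (fun n => Complex.exp (∫ x, (Complex.exp (s n x * Complex.I) - 1) ∂Λ)) atTop
      (𝓝 (Complex.exp (∫ x, (Complex.exp (f x * Complex.I) - 1) ∂Λ))) := by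
    refine (Complex.continuous_exp.tendsto _).comp (tendsto_integral_of_L1 _
      (integrable_exp_mul_I_sub_one hi).1 (.of_forall fun n => integrable_exp_mul_I_sub_one (hsi n))
      (tendsto_of_tendsto_of_tendsto_of_le_of_le tendsto_const_nhds hL1 (fun _ => bot_le)
        fun n => lintegral_mono fun x => ?_))
    rw [sub_sub_sub_cancel_right]
    exact enorm_exp_mul_I_sub_exp_mul_I_le _ _
  exact tendsto_nhds_unique hleft
    (hright.congr fun n => (hM.integral_exp_integral_simpleFunc (s n) (hsi n)).symm)

theorem charFun_map_integral [IsFiniteMeasure P] (hM : IsPoissonPointProcess P Λ M) {E : Type*}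
    [NormedAddCommGroup E] [InnerProductSpace ℝ E] [CompleteSpace E] [SecondCountableTopology E]
    [MeasurableSpace E] [BorelSpace E] {f : X → E} (hf : StronglyMeasurable f)
    (hi : Integrable f Λ) (t : E) :
    charFun (P.map fun ω => ∫ x, f x ∂(M ω)) t =
      Complex.exp (∫ x, (Complex.exp (⟪f x, t⟫ * Complex.I) - 1) ∂Λ) := by
  rw [charFun_apply, integral_map (hM.stronglyMeasurable_integral hf).measurable.aemeasurable
      (by fun_prop), ← hM.integral_exp_integral (hf.measurable.inner_const) (hi.inner_const t)]
  refine integral_congr_ae ?_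
  filter_upwards [hM.ae_integrable hf hi] with ω hω
  simp_rw [real_inner_comm t]
  rw [integral_inner hω t]

end CharacteristicFunctional

lemma measure_apply_eq_zero (hM : IsPoissonPointProcess P Λ M) {B : Set X} (hB : MeasurableSet B)
    (hfin : Λ B ≠ ∞) : P {ω | M ω B = 0} = ENNReal.ofReal (Real.exp (-Λ.real B)) := by
  have hpre : (fun k : ℕ => (k : ℝ≥0∞)) ⁻¹' {0} = {0} := by
    ext k
    simp
  rw [(hM.hasLaw B hB hfin).measure_eq (p := fun z => z = 0) (measurableSet_singleton 0),
    Set.ofPred_eq_eq_singleton, Measure.map_apply (by fun_prop) (measurableSet_singleton 0), hpre,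
    poissonMeasure_singleton]
  simp [Measure.real, ENNReal.toReal]

lemma ae_ne_zero [SigmaFinite Λ] (hM : IsPoissonPointProcess P Λ M) (htop : Λ Set.univ = ∞) :
    ∀ᵐ ω ∂P, M ω ≠ 0 := by
  have hexhaust : Tendsto (fun i => Λ.real (spanningSets Λ i)) atTop atTop := by
    have h := tendsto_measure_iUnion_atTop (μ := Λ) (monotone_spanningSets Λ)
    rw [iUnion_spanningSets, htop] at h
    rw [← ENNReal.tendsto_ofReal_nhds_top]
    exact h.congr fun i => (ofReal_measureReal (measure_spanningSets_lt_top Λ i).ne).symm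
  have hlim : Tendsto (fun i => ENNReal.ofReal (Real.exp (-Λ.real (spanningSets Λ i)))) atTop
      (𝓝 0) := by
    simpa using ENNReal.tendsto_ofReal
      (Real.tendsto_exp_atBot.comp (tendsto_neg_atTop_atBot.comp hexhaust))
  have hnull : P {ω | M ω = 0} = 0 := by
    refine le_antisymm (ge_of_tendsto' hlim fun i => ?_) bot_le
    rw [← hM.measure_apply_eq_zero (measurableSet_spanningSets Λ i)
      (measure_spanningSets_lt_top Λ i).ne]
    exact measure_mono fun ω (hω : M ω = 0) => by simp [hω]
  simpa [ae_iff] using hnull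

end IsPoissonPointProcess

lemma iIndepFun_curry {Ω ι : Type*} {κ : ι → Type*} {𝓧 : (i : ι) → κ i → Type*}
    [MeasurableSpace Ω] [∀ i j, MeasurableSpace (𝓧 i j)] {P : Measure Ω}
    {Y : (i : ι) → (j : κ i) → Ω → 𝓧 i j} (hY : ∀ i j, Measurable (Y i j))
    (h : iIndepFun (fun (p : (i : ι) × κ i) ω => Y p.1 p.2 ω) P) :
    iIndepFun (fun i ω => (Y i · ω)) P := by
  have := h.isProbabilityMeasure
  have (i : ι) (j : κ i) : IsProbabilityMeasure (P.map (Y i j)) :=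
    Measure.isProbabilityMeasure_map (hY i j).aemeasurable
  have hrow (i : ι) : P.map (fun ω => (Y i · ω)) = Measure.infinitePi fun j => P.map (Y i j) :=
    (iIndepFun_iff_map_fun_eq_infinitePi_map (by fun_prop)).1
      (h.precomp (g := fun j : κ i => ⟨i, j⟩) sigma_mk_injective)
  rw [iIndepFun_iff_map_fun_eq_infinitePi_map (by fun_prop)] at h ⊢
  simp_rw [hrow]
  rw [← Measure.infinitePi_map_piCurry (fun i j => P.map (Y i j)), ← h,
    Measure.map_map (by fun_prop) (by fun_prop)]
  rfl

section PoissonLimit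

lemma tendsto_poissonMeasure_finset {ι : Type*} {l : Filter ι} {r : ι → ℝ≥0} {r₀ : ℝ≥0}
    (h : Tendsto r l (𝓝 r₀)) (s : Finset ℕ) :
    Tendsto (fun i => poissonMeasure (r i) s) l (𝓝 (poissonMeasure r₀ s)) := by
  simp_rw [← sum_measure_singleton, poissonMeasure_singleton]
  refine tendsto_finsetSum _ fun k _ => ENNReal.tendsto_ofReal ?_
  have h' : Tendsto (fun i => (r i : ℝ)) l (𝓝 r₀) := (NNReal.continuous_coe.tendsto _).comp h
  exact ((Real.continuous_exp.tendsto _).comp h'.neg).mul (h'.pow k) |>.div_const _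

variable {Ω : Type*} [MeasurableSpace Ω] {P : Measure Ω}

lemma hasLaw_poisson_iSup [IsProbabilityMeasure P] {Y : ℕ → Ω → ℝ≥0∞} (hY : ∀ K, Measurable (Y K))
    (hmono : Monotone Y) {r : ℕ → ℝ≥0} {r₀ : ℝ≥0} (hr : Tendsto r atTop (𝓝 r₀))
    (hlaw : ∀ K, HasLaw (Y K) ((poissonMeasure (r K)).map fun k : ℕ => (k : ℝ≥0∞)) P) :
    HasLaw (fun ω => ⨆ K, Y K ω) ((poissonMeasure r₀).map fun k : ℕ => (k : ℝ≥0∞)) P := by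
  have hsup : Measurable fun ω => ⨆ K, Y K ω := .iSup hY
  refine ⟨hsup.aemeasurable, ?_⟩
  have := Measure.isProbabilityMeasure_map (μ := P) hsup.aemeasurable
  have : IsProbabilityMeasure ((poissonMeasure r₀).map fun k : ℕ => (k : ℝ≥0∞)) :=
    Measure.isProbabilityMeasure_map (by fun_prop)
  refine Measure.ext_of_Iic _ _ fun a => ?_
  rcases eq_or_ne a ∞ with rfl | ha
  · simp [Set.Iic_top]
  have hcdf (t : ℝ≥0) : ((poissonMeasure t).map fun k : ℕ => (k : ℝ≥0∞)) (Set.Iic a) =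
      poissonMeasure t (Finset.Iic ⌊a.toReal⌋₊) := by
    rw [Measure.map_apply (by fun_prop) measurableSet_Iic]
    congr 1 with k
    rw [Set.mem_preimage, Set.mem_Iic, Finset.mem_coe, Finset.mem_Iic,
      Nat.le_floor_iff ENNReal.toReal_nonneg, ← ENNReal.toReal_natCast,
      ENNReal.toReal_le_toReal (by simp) ha]
  have hlim : Tendsto (fun K => P (Y K ⁻¹' Set.Iic a)) atTop
      (𝓝 (P ((fun ω => ⨆ K, Y K ω) ⁻¹' Set.Iic a))) := by
    have hinter : (fun ω => ⨆ K, Y K ω) ⁻¹' Set.Iic a = ⋂ K, Y K ⁻¹' Set.Iic a := by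
      ext ω
      simp
    rw [hinter]
    exact tendsto_measure_iInter_atTop (fun K => (hY K measurableSet_Iic).nullMeasurableSet)
      (fun K L hKL ω hω => (hmono hKL ω).trans hω) ⟨0, measure_ne_top _ _⟩
  rw [Measure.map_apply hsup measurableSet_Iic, hcdf]
  refine tendsto_nhds_unique hlim ((tendsto_poissonMeasure_finset hr _).congr fun K => ?_)
  rw [← hcdf, ← (hlaw K).map_eq, Measure.map_apply (hY K) measurableSet_Iic]

lemma hasLaw_poisson_tsum {Y : ℕ → Ω → ℝ≥0∞} (hY : ∀ k, Measurable (Y k))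
    (hindep : iIndepFun Y P) {r : ℕ → ℝ≥0} {r₀ : ℝ≥0} (hr : HasSum r r₀)
    (hlaw : ∀ k, HasLaw (Y k) ((poissonMeasure (r k)).map fun k : ℕ => (k : ℝ≥0∞)) P) :
    HasLaw (fun ω => ∑' k, Y k ω) ((poissonMeasure r₀).map fun k : ℕ => (k : ℝ≥0∞)) P := by
  have := hindep.isProbabilityMeasure
  have hpartial (K : ℕ) : HasLaw (∑ k ∈ Finset.range (K + 1), Y k)
      ((poissonMeasure (∑ k ∈ Finset.range (K + 1), r k)).map fun k : ℕ => (k : ℝ≥0∞)) P := by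
    induction K with
    | zero => simpa using hlaw 0
    | succ K ih =>
      rw [Finset.sum_range_succ, Finset.sum_range_succ _ (K + 1)]
      exact (hindep.indepFun_finsetSum_of_notMem hY Finset.notMem_range_self)
        |>.hasLaw_add_map_cast_poissonMeasure ih (hlaw (K + 1))
  simp_rw [ENNReal.tsum_eq_iSup_nat' (tendsto_add_atTop_nat 1), ← Finset.sum_apply]
  refine hasLaw_poisson_iSup (fun K => by fun_prop) (fun K L hKL => ?_)
    (hr.tendsto_sum_nat.comp (tendsto_add_atTop_nat 1)) hpartial
  exact Finset.sum_le_sum_of_subset (Finset.range_mono (by omega))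

end PoissonLimit

/-! ### Construction of Poisson point processes -/

section PoissonSample

variable {X : Type*} [MeasurableSpace X]

/-- A Poisson number `N` of mean `r` together with an independent sequence of independent points
`x` of common law `π`. -/
def poissonSample (r : ℝ≥0) (π : Measure X) : Measure (ℕ × (ℕ → X)) :=
  (poissonMeasure r).prod (Measure.infinitePi fun _ : ℕ => π)

/-- The counting measure of the first `N` points of the sequence `x`, for `p = (N, x)`. -/
def sampleMeasure (p : ℕ × (ℕ → X)) : Measure X :=
  ∑ j ∈ Finset.range p.1, Measure.dirac (p.2 j)

lemma sampleMeasure_apply (p : ℕ × (ℕ → X)) {B : Set X} (hB : MeasurableSet B) :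
    sampleMeasure p B = ∑ j ∈ Finset.range p.1, B.indicator 1 (p.2 j) := by
  simp_rw [sampleMeasure, Measure.finsetSum_apply, Measure.dirac_apply' _ hB]

lemma measurable_sum_range {R : Type*} [AddCommMonoid R] [MeasurableSpace R] [MeasurableAdd₂ R]
    {g : X → R} (hg : Measurable g) :
    Measurable fun p : ℕ × (ℕ → X) => ∑ j ∈ Finset.range p.1, g (p.2 j) :=
  measurable_from_prod_countable_right fun n =>
    Finset.measurable_fun_sum (Finset.range n) fun j _ => hg.comp (measurable_pi_apply j)

lemma measurable_sampleMeasure : Measurable (sampleMeasure (X := X)) := by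
  refine Measure.measurable_of_measurable_coe _ fun B hB => ?_
  simp_rw [sampleMeasure_apply _ hB]
  exact measurable_sum_range (measurable_one.indicator hB)

lemma integral_pow_poissonMeasure (r : ℝ≥0) (z : ℂ) :
    ∫ k, z ^ k ∂(poissonMeasure r) = Complex.exp (r * (z - 1)) := by
  have hterm (k : ℕ) : (Real.exp (-r) * r ^ k / (k.factorial : ℝ)) • z ^ k =
      Complex.exp (-r) * ((r * z) ^ k / (k.factorial : ℂ)) := by
    rw [Complex.real_smul, mul_pow]
    push_cast
    ring
  simp_rw [integral_poissonMeasure, hterm]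
  rw [tsum_mul_left, (NormedSpace.expSeries_div_hasSum_exp (r * z)).tsum_eq,
    ← Complex.exp_eq_exp_ℂ, ← Complex.exp_add]
  ring_nf

variable (r : ℝ≥0) (π : Measure X) [IsProbabilityMeasure π]

instance : IsProbabilityMeasure (poissonSample r π) := by
  unfold poissonSample
  infer_instance

lemma integral_exp_sum_range_infinitePi (n : ℕ) {g : X → ℝ} (hg : Measurable g) :
    ∫ x : ℕ → X, Complex.exp ((∑ j ∈ Finset.range n, g (x j) : ℝ) * Complex.I)
      ∂(Measure.infinitePi fun _ : ℕ => π) = (∫ x, Complex.exp (g x * Complex.I) ∂π) ^ n := by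
  have hindep := (iIndepFun_infinitePi (P := fun _ : ℕ => π)
    (X := fun (_ : ℕ) x => Complex.exp (g x * Complex.I)) (fun _ => by fun_prop)).precomp
    (Fin.val_injective (n := n))
  have hcoord (j : ℕ) : ∫ x : ℕ → X, Complex.exp (g (x j) * Complex.I)
      ∂(Measure.infinitePi fun _ : ℕ => π) = ∫ x, Complex.exp (g x * Complex.I) ∂π :=
    (measurePreserving_eval_infinitePi (fun _ : ℕ => π) j).hasLaw.integral_comp
      (f := fun x => Complex.exp (g x * Complex.I)) (Measurable.aestronglyMeasurable (by fun_prop))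
  have hprod := hindep.integral_fun_prod_eq_prod_integral
    fun j => Measurable.aestronglyMeasurable (by fun_prop)
  simp only [hcoord, Finset.prod_const, Finset.card_univ, Fintype.card_fin] at hprod
  rw [← hprod]
  congr 1 with x
  rw [← Complex.exp_sum, Finset.sum_range, Complex.ofReal_sum, Finset.sum_mul]

lemma integral_exp_sum_range_poissonSample {g : X → ℝ} (hg : Measurable g) :
    ∫ p, Complex.exp ((∑ j ∈ Finset.range p.1, g (p.2 j) : ℝ) * Complex.I) ∂(poissonSample r π) =
      Complex.exp (r * ∫ x, (Complex.exp (g x * Complex.I) - 1) ∂π) := by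
  rw [poissonSample, integral_prod _ (integrable_exp_mul_I
    (measurable_sum_range hg).aestronglyMeasurable)]
  simp only [integral_exp_sum_range_infinitePi π _ hg]
  rw [integral_pow_poissonMeasure, integral_sub (integrable_exp_mul_I hg.aestronglyMeasurable)
    (integrable_const _)]
  simp

lemma exp_sum_indicator_mul_I_sub_one {X ι : Type*} [Fintype ι] {B : ι → Set X}
    (hd : Pairwise fun i j => Disjoint (B i) (B j)) (t : ι → ℝ) (x : X) :
    Complex.exp ((∑ i, (B i).indicator (fun _ => t i) x : ℝ) * Complex.I) - 1 =
      ∑ i, (B i).indicator (fun _ => Complex.exp (t i * Complex.I) - 1) x := by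
  by_cases h : ∃ i, x ∈ B i
  · obtain ⟨i, hi⟩ := h
    have hother (j : ι) (hj : j ≠ i) : x ∉ B j := fun hxj => (hd hj).le_bot ⟨hxj, hi⟩
    rw [Finset.sum_eq_single i (fun j _ hj => by simp [hother j hj]) (by simp),
      Finset.sum_eq_single i (fun j _ hj => by simp [hother j hj]) (by simp)]
    simp [hi]
  · push Not at h
    simp [h]

lemma integral_exp_sum_sampleMeasure {ι : Type*} [Fintype ι] {B : ι → Set X}
    (hB : ∀ i, MeasurableSet (B i)) (hd : Pairwise fun i j => Disjoint (B i) (B j)) (t : ι → ℝ) :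
    ∫ p, Complex.exp ((∑ i, (sampleMeasure p (B i)).toReal * t i : ℝ) * Complex.I)
        ∂(poissonSample r π) =
      ∏ i, Complex.exp (r * π.real (B i) * (Complex.exp (t i * Complex.I) - 1)) := by
  have hlinear (p : ℕ × (ℕ → X)) : ∑ i, (sampleMeasure p (B i)).toReal * t i =
      ∑ j ∈ Finset.range p.1, ∑ i, (B i).indicator (fun _ => t i) (p.2 j) := by
    rw [Finset.sum_comm]
    refine Finset.sum_congr rfl fun i _ => ?_
    rw [sampleMeasure_apply p (hB i), ENNReal.toReal_sum fun j _ => by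
      by_cases hj : p.2 j ∈ B i <;> simp [hj], Finset.sum_mul]
    refine Finset.sum_congr rfl fun j _ => ?_
    by_cases hj : p.2 j ∈ B i <;> simp [hj]
  simp_rw [hlinear]
  rw [integral_exp_sum_range_poissonSample r π (Finset.measurable_fun_sum _ fun i _ =>
    measurable_const.indicator (hB i)), ← Complex.exp_sum]
  simp_rw [exp_sum_indicator_mul_I_sub_one hd t]
  rw [integral_finsetSum _ fun i _ => (integrable_const _).indicator (hB i), Finset.mul_sum]
  congr 1
  refine Finset.sum_congr rfl fun i _ => ?_
  rw [integral_indicator (hB i), setIntegral_const, Complex.real_smul, mul_assoc]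

lemma charFun_map_sampleMeasure {B : Set X} (hB : MeasurableSet B) (t : ℝ) :
    charFun ((poissonSample r π).map fun p => (sampleMeasure p B).toReal) t =
      Complex.exp (r * π.real B * (Complex.exp (t * Complex.I) - 1)) := by
  have hmeas : Measurable fun p : ℕ × (ℕ → X) => sampleMeasure p B :=
    (Measure.measurable_coe hB).comp measurable_sampleMeasure
  have h := integral_exp_sum_sampleMeasure r π (B := fun _ : Unit => B) (fun _ => hB)
    (fun i j hij => (hij rfl).elim) fun _ => t
  simp only [Finset.univ_unique, Finset.sum_singleton, Finset.prod_singleton] at h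
  rw [charFun_apply, integral_map (by fun_prop) (by fun_prop), ← h]
  simp_rw [Real.inner_apply]

lemma sampleMeasure_apply_ne_top (p : ℕ × (ℕ → X)) {B : Set X} : sampleMeasure p B ≠ ∞ := by
  have : IsFiniteMeasure (sampleMeasure p) := by
    unfold sampleMeasure
    infer_instance
  exact measure_ne_top _ _

lemma hasLaw_sampleMeasure_apply {B : Set X} (hB : MeasurableSet B) :
    HasLaw (fun p => sampleMeasure p B)
      ((poissonMeasure (r * (π B).toNNReal)).map fun k : ℕ => (k : ℝ≥0∞)) (poissonSample r π) := by
  have hmeas : Measurable fun p : ℕ × (ℕ → X) => sampleMeasure p B :=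
    (Measure.measurable_coe hB).comp measurable_sampleMeasure
  have := Measure.isProbabilityMeasure_map (μ := poissonSample r π)
    (f := fun p => (sampleMeasure p B).toReal) (by fun_prop)
  have hreal : (poissonSample r π).map (fun p => (sampleMeasure p B).toReal) =
      (poissonMeasure (r * (π B).toNNReal)).map (Nat.cast : ℕ → ℝ) := by
    refine Measure.ext_of_charFun ?_
    ext t
    rw [charFun_map_sampleMeasure r π hB, charFun_map_cast_poissonMeasure, NNReal.coe_mul,
      Complex.ofReal_mul]
    rfl
  refine ⟨hmeas.aemeasurable, ?_⟩
  have hlift := congrArg (Measure.map ENNReal.ofReal) hreal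
  rw [Measure.map_map (by fun_prop) (by fun_prop), Measure.map_map (by fun_prop) (by fun_prop)]
    at hlift
  simpa [Function.comp_def, ENNReal.ofReal_toReal (sampleMeasure_apply_ne_top _)] using hlift

lemma iIndepFun_sampleMeasure_apply {ι : Type*} [Finite ι] {B : ι → Set X}
    (hB : ∀ i, MeasurableSet (B i)) (hd : Pairwise fun i j => Disjoint (B i) (B j)) :
    iIndepFun (fun i p => sampleMeasure p (B i)) (poissonSample r π) := by
  have := Fintype.ofFinite ι
  have hmeas (i : ι) : Measurable fun p : ℕ × (ℕ → X) => sampleMeasure p (B i) :=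
    (Measure.measurable_coe (hB i)).comp measurable_sampleMeasure
  have hreal : iIndepFun (fun i p => (sampleMeasure p (B i)).toReal) (poissonSample r π) := by
    rw [iIndepFun_iff_charFun_pi (fun i => by have := hmeas i; fun_prop)]
    intro t
    simp_rw [charFun_map_sampleMeasure r π (hB _)]
    rw [← integral_exp_sum_sampleMeasure r π hB hd, charFun_apply,
      integral_map (by fun_prop) (by fun_prop)]
    congr 1 with p
    simp [PiLp.inner_apply, mul_comm]
  simpa [Function.comp_def, ENNReal.ofReal_toReal (sampleMeasure_apply_ne_top _)] using
    hreal.comp (fun _ => ENNReal.ofReal) fun _ => ENNReal.measurable_ofReal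

lemma isPoissonPointProcess_sampleMeasure {X : Type*} [PseudoMetricSpace X] [MeasurableSpace X]
    (r : ℝ≥0) (π : Measure X) [IsProbabilityMeasure π] :
    IsPoissonPointProcess (poissonSample r π) ((r : ℝ≥0∞) • π) sampleMeasure where
  measurable := measurable_sampleMeasure
  counting p B hB _ := by
    classical
    refine ⟨∑ j ∈ Finset.range p.1, B.indicator 1 (p.2 j), ?_⟩
    rw [sampleMeasure_apply p hB, Nat.cast_sum]
    refine Finset.sum_congr rfl fun j _ => ?_
    by_cases hj : p.2 j ∈ B <;> simp [hj]
  hasLaw B hB _ := by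
    simpa using hasLaw_sampleMeasure_apply r π hB
  indep m B hB hd := iIndepFun_sampleMeasure_apply r π hB hd

end PoissonSample

namespace IsPoissonPointProcess

variable {X Ω : Type*} [PseudoMetricSpace X] [MeasurableSpace X] [MeasurableSpace Ω]
  {P : Measure Ω}

lemma restrict {Λ : Measure X} {M : Ω → Measure X} (hM : IsPoissonPointProcess P Λ M) {S : Set X}
    (hS : MeasurableSet S) :
    IsPoissonPointProcess P (Λ.restrict S) fun ω => (M ω).restrict S where
  measurable := by
    refine Measure.measurable_of_measurable_coe _ fun B hB => ?_
    simp_rw [Measure.restrict_apply hB]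
    exact hM.measurable_apply (hB.inter hS)
  counting ω B hB hb := by
    rw [Measure.restrict_apply hB]
    exact hM.counting ω _ (hB.inter hS) (hb.subset Set.inter_subset_left)
  hasLaw B hB hfin := by
    simp_rw [Measure.restrict_apply hB] at hfin ⊢
    exact hM.hasLaw _ (hB.inter hS) hfin
  indep m B hB hd := by
    simp_rw [Measure.restrict_apply (hB _)]
    exact hM.indep m _ (fun i => (hB i).inter hS)
      fun i j hij => (hd hij).mono Set.inter_subset_left Set.inter_subset_left

lemma comp_measurePreserving {Ω' : Type*} [MeasurableSpace Ω'] {P' : Measure Ω'} {φ : Ω' → Ω}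
    (hφ : MeasurePreserving φ P' P) {Λ : Measure X} {M : Ω → Measure X}
    (hM : IsPoissonPointProcess P Λ M) : IsPoissonPointProcess P' Λ (M ∘ φ) where
  measurable := hM.measurable.comp hφ.measurable
  counting ω := hM.counting (φ ω)
  hasLaw B hB hfin := (hM.hasLaw B hB hfin).comp hφ.hasLaw
  indep m B hB hd := by
    have hindep := hM.indep m B hB hd
    rw [iIndepFun_iff_measure_inter_preimage_eq_mul] at hindep ⊢
    intro T A hA
    have hmeas (i : Fin m) (hi : i ∈ T) : MeasurableSet ((fun ω => M ω (B i)) ⁻¹' A i) :=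
      hM.measurable_apply (hB i) (hA i hi)
    have h := hindep T hA
    rw [← hφ.measure_preimage (T.measurableSet_biInter hmeas).nullMeasurableSet] at h
    simp only [Set.preimage_iInter] at h
    exact h.trans <| Finset.prod_congr rfl fun i hi =>
      (hφ.measure_preimage (hmeas i hi).nullMeasurableSet).symm

lemma iIndepFun_family_apply {Λ : ℕ → Measure X} {M : ℕ → Ω → Measure X}
    (hM : ∀ k, IsPoissonPointProcess P (Λ k) (M k)) (hindep : iIndepFun M P) {m : ℕ}
    {B : Fin m → Set X} (hB : ∀ i, MeasurableSet (B i))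
    (hd : Pairwise fun i j => Disjoint (B i) (B j)) :
    iIndepFun (fun i ω (k : ℕ) => M k ω (B i)) P := by
  have hcell : iIndepFun (fun (p : ℕ × Fin m) ω => M p.1 ω (B p.2)) P :=
    iIndepFun_uncurry' (fun k i => (hM k).measurable_apply (hB i))
      (hindep.comp (fun _ μ i => μ (B i)) fun _ =>
        measurable_pi_lambda _ fun i => Measure.measurable_coe (hB i))
      fun k => (hM k).indep m B hB hd
  exact iIndepFun_curry (Y := fun (i : Fin m) (k : ℕ) ω => M k ω (B i))
    (fun i k => (hM k).measurable_apply (hB i))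
    (hcell.precomp (g := fun p : (_ : Fin m) × ℕ => (p.2, p.1)) fun p q h => by
      simp only [Prod.mk.injEq] at h
      exact Sigma.ext h.2 (heq_of_eq h.1))

theorem sum {Λ : ℕ → Measure X} {M : ℕ → Ω → Measure X}
    (hM : ∀ k, IsPoissonPointProcess P (Λ k) (M k)) (hindep : iIndepFun M P)
    (hlf : ∀ B, Bornology.IsBounded B → ∃ K, ∀ k ≥ K, ∀ ω, M k ω B = 0) :
    IsPoissonPointProcess P (Measure.sum Λ) fun ω => Measure.sum fun k => M k ω where
  measurable := by
    refine Measure.measurable_of_measurable_coe _ fun B hB => ?_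
    simp_rw [Measure.sum_apply _ hB]
    exact Measurable.tsum fun k => (hM k).measurable_apply hB
  counting ω B hB hb := by
    obtain ⟨K, hK⟩ := hlf B hb
    choose N hN using fun k => (hM k).counting ω B hB hb
    refine ⟨∑ k ∈ Finset.range K, N k, ?_⟩
    rw [Measure.sum_apply _ hB, tsum_eq_sum (s := Finset.range K) fun k hk =>
      hK k (by simpa using hk) ω]
    push_cast
    exact Finset.sum_congr rfl fun k _ => hN k
  hasLaw B hB hfin := by
    simp_rw [Measure.sum_apply _ hB] at hfin ⊢
    have hfin' (k : ℕ) : Λ k B ≠ ∞ := ENNReal.ne_top_of_tsum_ne_top hfin k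
    refine hasLaw_poisson_tsum (fun k => (hM k).measurable_apply hB)
      (hindep.comp (fun _ μ => μ B) fun _ => Measure.measurable_coe hB) ?_
      fun k => (hM k).hasLaw B hB (hfin' k)
    rw [← ENNReal.hasSum_coe, ENNReal.coe_toNNReal hfin]
    simpa only [ENNReal.coe_toNNReal (hfin' _)] using ENNReal.summable.hasSum
  indep m B hB hd := by
    simp_rw [Measure.sum_apply _ (hB _)]
    exact (iIndepFun_family_apply hM hindep hB hd).comp (fun _ N => ∑' k, N k)
      fun _ => Measurable.tsum fun k => measurable_pi_apply k

end IsPoissonPointProcess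

lemma exists_isProbabilityMeasure_smul_eq {X : Type*} [MeasurableSpace X] [Nonempty X]
    (μ : Measure X) [IsFiniteMeasure μ] :
    ∃ π : Measure X, IsProbabilityMeasure π ∧ μ Set.univ • π = μ := by
  rcases eq_zero_or_neZero μ with rfl | _
  · exact ⟨Measure.dirac (Classical.arbitrary X), inferInstance, by simp⟩
  · refine ⟨(μ Set.univ)⁻¹ • μ, inferInstance, ?_⟩
    rw [smul_smul, ENNReal.mul_inv_cancel (NeZero.ne _) (measure_ne_top _ _), one_smul]

theorem exists_isPoissonPointProcess {X : Type*} [PseudoMetricSpace X] [MeasurableSpace X]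
    [Nonempty X] (Λ : Measure X) {S : ℕ → Set X} (hS : ∀ k, MeasurableSet (S k))
    (hSd : Pairwise fun i j => Disjoint (S i) (S j)) (hSu : ⋃ k, S k = Set.univ)
    (hfin : ∀ k, Λ (S k) ≠ ∞)
    (hbdd : ∀ B : Set X, Bornology.IsBounded B → ∃ K, ∀ k ≥ K, Disjoint B (S k)) :
    ∃ (P : Measure (ℕ → ℕ × (ℕ → X))) (_ : IsProbabilityMeasure P)
      (M : (ℕ → ℕ × (ℕ → X)) → Measure X), IsPoissonPointProcess P Λ M := by
  have (k : ℕ) : IsFiniteMeasure (Λ.restrict (S k)) := ⟨by simpa using (hfin k).lt_top⟩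
  choose π hπ hΛ using fun k => exists_isProbabilityMeasure_smul_eq (Λ.restrict (S k))
  let r (k : ℕ) : ℝ≥0 := (Λ (S k)).toNNReal
  have hpiece (k : ℕ) : IsPoissonPointProcess (poissonSample (r k) (π k)) (Λ.restrict (S k))
      fun p => (sampleMeasure p).restrict (S k) := by
    have h := (isPoissonPointProcess_sampleMeasure (r k) (π k)).restrict (hS k)
    rw [ENNReal.coe_toNNReal (hfin k), ← Measure.restrict_apply_univ, hΛ k,
      Measure.restrict_restrict (hS k), Set.inter_self] at h
    exact h
  refine ⟨Measure.infinitePi fun k => poissonSample (r k) (π k), inferInstance,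
    fun ω => Measure.sum fun k => (sampleMeasure (ω k)).restrict (S k), ?_⟩
  rw [← Measure.restrict_univ (μ := Λ), ← hSu, Measure.restrict_iUnion hSd hS]
  refine .sum (fun k => (hpiece k).comp_measurePreserving
    (measurePreserving_eval_infinitePi (fun k => poissonSample (r k) (π k)) k))
    (iIndepFun_infinitePi (X := fun k p => (sampleMeasure p).restrict (S k))
      fun k => (hpiece k).measurable) fun B hb => ?_
  obtain ⟨K, hK⟩ := hbdd B hb
  refine ⟨K, fun k hk ω => ?_⟩
  rw [Measure.restrict_apply' (hS k), (hK k hk).inter_eq, measure_empty]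

/-! ### The gnomonic chart and Laplace's method on the sphere -/

section Gnomonic

variable {E : Type*} [NormedAddCommGroup E] [InnerProductSpace ℝ E]

lemma inner_le_one_of_mem_sphere (q x : sphere (0 : E) 1) : ⟪(q : E), (x : E)⟫ ≤ 1 := by
  simpa using real_inner_le_norm (q : E) (x : E)

lemma inner_tangent_eq_zero (q : sphere (0 : E) 1) (v : (ℝ ∙ (q : E))ᗮ) : ⟪(q : E), (v : E)⟫ = 0 :=
  Submodule.mem_orthogonal_singleton_iff_inner_right.1 v.2

lemma norm_add_tangent_sq (q : sphere (0 : E) 1) (v : (ℝ ∙ (q : E))ᗮ) :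
    ‖(q : E) + v‖ ^ 2 = 1 + ‖v‖ ^ 2 := by
  rw [norm_add_sq_real, inner_tangent_eq_zero, norm_eq_of_mem_sphere, Submodule.coe_norm]
  ring

lemma one_le_norm_add_tangent (q : sphere (0 : E) 1) (v : (ℝ ∙ (q : E))ᗮ) : 1 ≤ ‖(q : E) + v‖ := by
  nlinarith [norm_add_tangent_sq q v, norm_nonneg ((q : E) + v), sq_nonneg ‖v‖]

lemma norm_add_tangent_pos (q : sphere (0 : E) 1) (v : (ℝ ∙ (q : E))ᗮ) : 0 < ‖(q : E) + v‖ :=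
  one_pos.trans_le (one_le_norm_add_tangent q v)

/-- The inverse of the gnomonic (central) projection of the open hemisphere around `q` onto the
tangent space at `q`. -/
def gnomonic (q : sphere (0 : E) 1) (v : (ℝ ∙ (q : E))ᗮ) : sphere (0 : E) 1 :=
  ⟨‖(q : E) + v‖⁻¹ • ((q : E) + v), by
    rw [mem_sphere_zero_iff_norm, norm_smul, norm_inv, norm_norm,
      inv_mul_cancel₀ (norm_add_tangent_pos q v).ne']⟩

lemma coe_gnomonic (q : sphere (0 : E) 1) (v : (ℝ ∙ (q : E))ᗮ) :
    (gnomonic q v : E) = ‖(q : E) + v‖⁻¹ • ((q : E) + v) :=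
  rfl

lemma continuous_gnomonic (q : sphere (0 : E) 1) : Continuous (gnomonic q) := by
  refine Continuous.subtype_mk ?_ _
  have h : Continuous fun v : (ℝ ∙ (q : E))ᗮ => (q : E) + v := by fun_prop
  exact (h.norm.inv₀ fun v => (norm_add_tangent_pos q v).ne').smul h

@[simp]
lemma gnomonic_zero (q : sphere (0 : E) 1) : gnomonic q 0 = q := by
  ext; simp [gnomonic]

lemma inner_gnomonic (q : sphere (0 : E) 1) (v : (ℝ ∙ (q : E))ᗮ) :
    ⟪(q : E), (gnomonic q v : E)⟫ = ‖(q : E) + v‖⁻¹ := by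
  simp [gnomonic, inner_smul_right, inner_add_right, inner_tangent_eq_zero]

lemma gnomonic_injective (q : sphere (0 : E) 1) : Function.Injective (gnomonic q) := by
  intro v w h
  have hnorm : ‖(q : E) + v‖⁻¹ = ‖(q : E) + w‖⁻¹ := by rw [← inner_gnomonic, h, inner_gnomonic]
  have hcoe := congrArg ((↑) : sphere (0 : E) 1 → E) h
  rw [coe_gnomonic, coe_gnomonic, hnorm] at hcoe
  exact Subtype.ext (add_left_cancel
    (smul_right_injective E (inv_pos.2 (norm_add_tangent_pos q w)).ne' hcoe))

/-- The open spherical cap `{x | a < ⟨q, x⟩}` around `q`. -/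
def sphericalCap (q : sphere (0 : E) 1) (a : ℝ) : Set (sphere (0 : E) 1) :=
  {x | a < ⟪(q : E), (x : E)⟫}

lemma isOpen_sphericalCap (q : sphere (0 : E) 1) (a : ℝ) : IsOpen (sphericalCap q a) :=
  isOpen_lt continuous_const (by fun_prop)

lemma sphericalCap_mem_nhds (q : sphere (0 : E) 1) {a : ℝ} (ha : a < 1) :
    sphericalCap q a ∈ 𝓝 q :=
  (isOpen_sphericalCap q a).mem_nhds (by simpa [sphericalCap] using ha)

lemma exists_sphericalCap_subset (q : sphere (0 : E) 1) {U : Set (sphere (0 : E) 1)}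
    (hU : U ∈ 𝓝 q) : ∃ a, 0 < a ∧ a < 1 ∧ sphericalCap q a ⊆ U := by
  obtain ⟨ε, hε, hball⟩ := Metric.mem_nhds_iff.1 hU
  refine ⟨max (1 / 2) (1 - ε ^ 2 / 2), by positivity, max_lt (by norm_num)
    (by linarith [pow_pos hε 2]), fun x hx => hball ?_⟩
  have hinner : 1 - ε ^ 2 / 2 < ⟪(x : E), (q : E)⟫ := by
    rw [real_inner_comm]
    exact (max_lt_iff.1 hx).2
  rw [mem_ball, Subtype.dist_eq, dist_eq_norm, ← sq_lt_sq₀ (norm_nonneg _) hε.le,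
    norm_sub_sq_real, norm_eq_of_mem_sphere, norm_eq_of_mem_sphere]
  linarith

lemma mul_norm_sq_le_of_gnomonic_mem_sphericalCap (q : sphere (0 : E) 1) {a : ℝ} (ha : 0 < a)
    {v : (ℝ ∙ (q : E))ᗮ} (hv : gnomonic q v ∈ sphericalCap q a) :
    a ^ 2 / 2 * ‖v‖ ^ 2 ≤ 1 - ⟪(q : E), (gnomonic q v : E)⟫ := by
  have hu : a < ⟪(q : E), (gnomonic q v : E)⟫ := hv
  have hsq := norm_add_tangent_sq q v
  rw [inner_gnomonic] at hu ⊢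
  set N := ‖(q : E) + v‖
  have hN : 1 ≤ N := one_le_norm_add_tangent q v
  have haN : a * N < 1 := by
    rwa [lt_inv_comm₀ ha (by positivity), ← one_div, lt_div_iff₀ ha, mul_comm] at hu
  have hle : a ^ 2 / 2 * (N + 1) * N ≤ 1 := by nlinarith [mul_pos ha (one_pos.trans_le hN)]
  calc a ^ 2 / 2 * ‖v‖ ^ 2 = a ^ 2 / 2 * (N + 1) * N * (1 - N⁻¹) := by
        rw [show ‖v‖ ^ 2 = N ^ 2 - 1 by linarith]
        field_simp
        ring
    _ ≤ 1 - N⁻¹ := mul_le_of_le_one_left (sub_nonneg.2 (inv_le_one_of_one_le₀ hN)) hle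

open scoped Pointwise in
lemma smul_add_tangent_mem_cone_iff (q : sphere (0 : E) 1) (v : (ℝ ∙ (q : E))ᗮ) {s : ℝ}
    (hs : 0 < s) (A : Set (sphere (0 : E) 1)) :
    s • ((q : E) + v) ∈ Set.Ioo (0 : ℝ) 1 • ((↑) '' A : Set E) ↔
      s < ‖(q : E) + v‖⁻¹ ∧ gnomonic q v ∈ A := by
  have hN := norm_add_tangent_pos q v
  rw [Set.mem_smul]
  constructor
  · rintro ⟨t, ht, _, ⟨x, hx, rfl⟩, h⟩
    have ht' : t = s * ‖(q : E) + v‖ := by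
      simpa [norm_smul, -smul_add, abs_of_pos ht.1, abs_of_pos hs] using congrArg norm h
    have hgn : gnomonic q v = x := by
      ext1
      rw [coe_gnomonic, ← smul_right_injective E ht.1.ne' |>.eq_iff, h, smul_smul, ht']
      field_simp
    exact ⟨by rw [lt_inv_comm₀ hs hN, ← one_div, lt_div_iff₀ hs, mul_comm, ← ht']; exact ht.2,
      hgn ▸ hx⟩
  · rintro ⟨hlt, hA⟩
    refine ⟨s * ‖(q : E) + v‖, ⟨by positivity, (lt_inv_mul_iff₀' hN).1 (by simpa using hlt)⟩, _,
      Set.mem_image_of_mem _ hA, ?_⟩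
    rw [coe_gnomonic]
    simp only [smul_smul]
    field_simp

variable [FiniteDimensional ℝ E]

lemma finrank_tangent_add_one (q : sphere (0 : E) 1) :
    Module.finrank ℝ (ℝ ∙ (q : E))ᗮ + 1 = Module.finrank ℝ E := by
  rw [← (ℝ ∙ (q : E)).finrank_add_finrank_orthogonal,
    finrank_span_singleton (ne_zero_of_mem_unit_sphere q), add_comm]

variable [MeasurableSpace E] [BorelSpace E]

lemma measurableEmbedding_gnomonic (q : sphere (0 : E) 1) : MeasurableEmbedding (gnomonic q) :=
  (continuous_gnomonic q).measurableEmbedding (gnomonic_injective q)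

lemma measurePreserving_smul_add_tangent (q : sphere (0 : E) 1) :
    MeasurePreserving (fun p : ℝ × (ℝ ∙ (q : E))ᗮ => p.1 • (q : E) + (p.2 : E))
      ((volume : Measure ℝ).prod volume) volume := by
  have hline := (LinearIsometryEquiv.toSpanUnitSingleton (𝕜 := ℝ) (q : E)
    (by simp)).measurePreserving
  have hprod := (WithLp.volume_preserving_toLp (ℝ ∙ (q : E)) ((ℝ ∙ (q : E))ᗮ :)).comp
    (hline.prod (MeasurePreserving.id (volume : Measure (ℝ ∙ (q : E))ᗮ)))
  have hcomp : (fun p : ℝ × (ℝ ∙ (q : E))ᗮ => p.1 • (q : E) + (p.2 : E)) =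
      (ℝ ∙ (q : E)).orthogonalDecomposition.symm ∘ WithLp.toLp 2 ∘
        Prod.map (LinearIsometryEquiv.toSpanUnitSingleton (𝕜 := ℝ) (q : E) (by simp)) id := by
    funext p
    simp
  rw [hcomp]
  exact (ℝ ∙ (q : E)).orthogonalDecomposition.symm.measurePreserving.comp hprod

lemma lintegral_comp_smul_pos {F : Type*} [NormedAddCommGroup F] [NormedSpace ℝ F]
    [FiniteDimensional ℝ F] [MeasurableSpace F] [BorelSpace F] (μ : Measure F) [μ.IsAddHaarMeasure]
    {f : F → ℝ≥0∞} (hf : Measurable f) {s : ℝ} (hs : 0 < s) :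
    ∫⁻ w, f w ∂μ = ENNReal.ofReal (s ^ Module.finrank ℝ F) * ∫⁻ v, f (s • v) ∂μ := by
  rw [← lintegral_map hf (measurable_const_smul s), Measure.map_addHaar_smul μ hs.ne',
    lintegral_smul_measure, smul_eq_mul, ← mul_assoc, ← ENNReal.ofReal_mul (by positivity),
    abs_of_pos (by positivity), mul_inv_cancel₀ (by positivity), ENNReal.ofReal_one, one_mul]

lemma setLIntegral_inner_pos (q : sphere (0 : E) 1) {f : E → ℝ≥0∞} (hf : Measurable f) :
    ∫⁻ x in {x | 0 < ⟪(q : E), x⟫}, f x =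
      ∫⁻ v : (ℝ ∙ (q : E))ᗮ, ∫⁻ s in Set.Ioi 0,
        ENNReal.ofReal (s ^ Module.finrank ℝ (ℝ ∙ (q : E))ᗮ) * f (s • ((q : E) + v)) := by
  have hH : MeasurableSet {x : E | 0 < ⟪(q : E), x⟫} :=
    measurableSet_lt measurable_const (by fun_prop)
  have hpre : (fun p : ℝ × (ℝ ∙ (q : E))ᗮ => p.1 • (q : E) + (p.2 : E)) ⁻¹'
      {x | 0 < ⟪(q : E), x⟫} = Set.Ioi 0 ×ˢ Set.univ := by
    ext p
    simp [inner_add_right, inner_smul_right, inner_tangent_eq_zero]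
  have hslice (s : ℝ) (hs : s ∈ Set.Ioi 0) :
      ∫⁻ w : (ℝ ∙ (q : E))ᗮ, f (s • (q : E) + w) = ∫⁻ v : (ℝ ∙ (q : E))ᗮ,
        ENNReal.ofReal (s ^ Module.finrank ℝ (ℝ ∙ (q : E))ᗮ) * f (s • ((q : E) + v)) := by
    rw [lintegral_comp_smul_pos volume (by fun_prop) hs, ← lintegral_const_mul' _ _ (by simp)]
    simp only [Submodule.coe_smul, smul_add]
  rw [← (measurePreserving_smul_add_tangent q).setLIntegral_comp_preimage hH hf, hpre,
    ← Measure.prod_restrict, Measure.restrict_univ, lintegral_prod _ (by fun_prop),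
    setLIntegral_congr_fun measurableSet_Ioi hslice, lintegral_lintegral_swap (by fun_prop)]

lemma lintegral_Ioo_zero_pow (n : ℕ) {a : ℝ} (ha : 0 < a) :
    ∫⁻ s in Set.Ioo 0 a, ENNReal.ofReal (s ^ n) = ENNReal.ofReal (a ^ (n + 1) / (n + 1)) := by
  rw [Measure.restrict_congr_set Ioo_ae_eq_Ioc,
    ← ofReal_integral_eq_lintegral_ofReal (intervalIntegral.intervalIntegrable_pow _).1,
    ← intervalIntegral.integral_of_le ha.le]
  · simp
  · filter_upwards [ae_restrict_mem measurableSet_Ioc] with y hy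
    exact pow_nonneg hy.1.le _

open scoped Pointwise in
lemma measurableSet_cone {A : Set (sphere (0 : E) 1)} (hA : MeasurableSet A) :
    MeasurableSet (Set.Ioo (0 : ℝ) 1 • ((↑) '' A : Set E)) := by
  have hA' : MeasurableSet ((↑) '' A : Set E) :=
    (MeasurableEmbedding.subtype_coe isClosed_sphere.measurableSet).measurableSet_image.2 hA
  rw [← Set.image_smul_prod]
  refine (measurableSet_Ioo.prod hA').image_of_continuousOn_injOn (by fun_prop) ?_
  rintro ⟨s, _⟩ ⟨hs, x, -, rfl⟩ ⟨t, _⟩ ⟨ht, y, -, rfl⟩ h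
  simp only at hs ht h
  have hst : s = t := by
    simpa [norm_smul, abs_of_pos hs.1, abs_of_pos ht.1] using congrArg norm h
  rw [Prod.mk.injEq]
  exact ⟨hst, smul_right_injective E ht.1.ne' (hst ▸ h)⟩

open scoped Pointwise in
lemma volume_cone_sphericalCap (q : sphere (0 : E) 1) {A : Set (sphere (0 : E) 1)}
    (hA : MeasurableSet A) (hcap : A ⊆ sphericalCap q 0) :
    volume (Set.Ioo (0 : ℝ) 1 • ((↑) '' A : Set E)) = ∫⁻ v in gnomonic q ⁻¹' A,
      ENNReal.ofReal (‖(q : E) + v‖⁻¹ ^ Module.finrank ℝ E / Module.finrank ℝ E) := by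
  set K : Set E := Set.Ioo (0 : ℝ) 1 • ((↑) '' A)
  have hK : MeasurableSet K := measurableSet_cone hA
  have hsub : K ⊆ {x | 0 < ⟪(q : E), x⟫} := by
    rintro _ ⟨s, hs, _, ⟨x, hx, rfl⟩, rfl⟩
    rw [Set.mem_ofPred_eq, inner_smul_right]
    exact mul_pos hs.1 (hcap hx)
  have hray (v : (ℝ ∙ (q : E))ᗮ) (s : ℝ) (hs : s ∈ Set.Ioi 0) :
      ENNReal.ofReal (s ^ Module.finrank ℝ (ℝ ∙ (q : E))ᗮ) * K.indicator 1 (s • ((q : E) + v)) =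
        (gnomonic q ⁻¹' A).indicator (fun v => (Set.Iio ‖(q : E) + v‖⁻¹).indicator
          (fun s => ENNReal.ofReal (s ^ Module.finrank ℝ (ℝ ∙ (q : E))ᗮ)) s) v := by
    classical
    simp only [Set.indicator_apply, K, smul_add_tangent_mem_cone_iff q v hs, Set.mem_preimage,
      Set.mem_Iio]
    split_ifs <;> simp_all
  rw [← Measure.restrict_eq_self volume hsub, ← lintegral_indicator_one hK,
    setLIntegral_inner_pos q (measurable_one.indicator hK),
    ← lintegral_indicator (measurableEmbedding_gnomonic q |>.measurable hA)]
  refine lintegral_congr fun v => ?_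
  rw [setLIntegral_congr_fun measurableSet_Ioi (hray v)]
  by_cases hv : v ∈ gnomonic q ⁻¹' A
  · simp only [Set.indicator_of_mem hv]
    rw [setLIntegral_indicator measurableSet_Iio, Set.Iio_inter_Ioi,
      lintegral_Ioo_zero_pow _ (inv_pos.2 (norm_add_tangent_pos q v)), finrank_tangent_add_one,
      ← finrank_tangent_add_one q, Nat.cast_add_one]
  · simp [Set.indicator_of_notMem hv]

/-- In the coordinates `x = s (q + v)`, the cone over a set in the hemisphere lies below the graph
of `s = ‖q + v‖⁻¹`. -/
lemma toSphere_restrict_hemisphere (q : sphere (0 : E) 1) :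
    (volume : Measure E).toSphere.restrict (sphericalCap q 0) =
      ((volume : Measure (ℝ ∙ (q : E))ᗮ).withDensity fun v =>
        ENNReal.ofReal (‖(q : E) + v‖⁻¹ ^ Module.finrank ℝ E)).map (gnomonic q) := by
  ext A hA
  have hgn := (measurableEmbedding_gnomonic q).measurable
  have hcap := (isOpen_sphericalCap q 0).measurableSet
  have hpre : gnomonic q ⁻¹' (A ∩ sphericalCap q 0) = gnomonic q ⁻¹' A := by
    ext v
    simp only [sphericalCap, Set.mem_preimage, Set.mem_inter_iff, Set.mem_ofPred_eq, inner_gnomonic,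
      inv_pos, norm_add_tangent_pos, and_true]
  rw [Measure.restrict_apply hA, Measure.toSphere_apply' _ (hA.inter hcap),
    volume_cone_sphericalCap q (hA.inter hcap) Set.inter_subset_right, hpre,
    Measure.map_apply hgn hA, withDensity_apply _ (hgn hA), ← lintegral_const_mul' _ _ (by simp)]
  refine lintegral_congr fun v => ?_
  have hd : (Module.finrank ℝ E : ℝ) ≠ 0 := by
    rw [← finrank_tangent_add_one q]
    positivity
  rw [← ENNReal.ofReal_natCast, ← ENNReal.ofReal_mul (by positivity), mul_div_cancel₀ _ hd]

end Gnomonic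

section Localization

variable {E : Type*} [NormedAddCommGroup E] [InnerProductSpace ℝ E]
  {F : Type*} [NormedAddCommGroup F] [NormedSpace ℝ F] {ι : Type*} {l : Filter ι}

lemma tendsto_inv_sqrt_smul {V : Type*} [NormedAddCommGroup V] [NormedSpace ℝ V] {β : ι → ℝ}
    (hβ : Tendsto β l atTop) (v : V) : Tendsto (fun i => (√(β i))⁻¹ • v) l (𝓝 0) := by
  simpa using (tendsto_inv_atTop_zero.comp (Real.tendsto_sqrt_atTop.comp hβ)).smul_const v

lemma tendsto_gnomonic (q : sphere (0 : E) 1) {v : ι → (ℝ ∙ (q : E))ᗮ}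
    (hv : Tendsto v l (𝓝 0)) : Tendsto (fun i => gnomonic q (v i)) l (𝓝 q) := by
  simpa [Function.comp_def] using ((continuous_gnomonic q).tendsto 0).comp hv

/-- The integrand on the tangent space which represents the integral of `f` over the spherical cap
`sphericalCap q a` in the gnomonic chart. -/
def capPullback (q : sphere (0 : E) 1) (a : ℝ) (f : sphere (0 : E) 1 → F) :
    (ℝ ∙ (q : E))ᗮ → F :=
  (gnomonic q ⁻¹' sphericalCap q a).indicator fun v =>
    ‖(q : E) + v‖⁻¹ ^ Module.finrank ℝ E • f (gnomonic q v)

lemma norm_capPullback_inv_sqrt_smul_le (q : sphere (0 : E) 1) {a b C c : ℝ} (ha : 0 < a)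
    (hb : 0 < b) (hC : 0 ≤ C) (hc : 0 < c) {f : sphere (0 : E) 1 → F}
    (hf : ∀ x ∈ sphericalCap q a, ‖f x‖ ≤ C * Real.exp (-c * (b * (1 - ⟪(q : E), (x : E)⟫))))
    (w : (ℝ ∙ (q : E))ᗮ) :
    ‖capPullback q a f ((√b)⁻¹ • w)‖ ≤ C * Real.exp (-(c * (a ^ 2 / 2)) * ‖w‖ ^ 2) := by
  set v := (√b)⁻¹ • w with hv
  by_cases hvcap : v ∈ gnomonic q ⁻¹' sphericalCap q a
  · have hdensity : ‖‖(q : E) + v‖⁻¹ ^ Module.finrank ℝ E‖ ≤ 1 := by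
      rw [Real.norm_of_nonneg (by positivity)]
      exact pow_le_one₀ (by positivity) (inv_le_one_of_one_le₀ (one_le_norm_add_tangent q v))
    have hw : ‖w‖ ^ 2 = b * ‖v‖ ^ 2 := by
      rw [hv, norm_smul, norm_inv, Real.norm_of_nonneg (by positivity), mul_pow, inv_pow,
        Real.sq_sqrt hb.le, mul_inv_cancel_left₀ hb.ne']
    rw [capPullback, Set.indicator_of_mem hvcap, norm_smul]
    calc ‖‖(q : E) + v‖⁻¹ ^ Module.finrank ℝ E‖ * ‖f (gnomonic q v)‖ ≤ ‖f (gnomonic q v)‖ :=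
          mul_le_of_le_one_left (norm_nonneg _) hdensity
      _ ≤ C * Real.exp (-c * (b * (1 - ⟪(q : E), (gnomonic q v : E)⟫))) := hf _ hvcap
      _ ≤ C * Real.exp (-c * (b * (a ^ 2 / 2 * ‖v‖ ^ 2))) := by
          rw [neg_mul, neg_mul]
          gcongr
          exact mul_norm_sq_le_of_gnomonic_mem_sphericalCap q ha hvcap
      _ = C * Real.exp (-(c * (a ^ 2 / 2)) * ‖w‖ ^ 2) := by
          rw [hw]
          ring_nf
  · rw [capPullback, Set.indicator_of_notMem hvcap, norm_zero]
    positivity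

lemma tendsto_capPullback (q : sphere (0 : E) 1) {a : ℝ} (ha : a < 1)
    {f : ι → sphere (0 : E) 1 → F} {v : ι → (ℝ ∙ (q : E))ᗮ} (hv : Tendsto v l (𝓝 0)) {y : F}
    (hf : Tendsto (fun i => f i (gnomonic q (v i))) l (𝓝 y)) :
    Tendsto (fun i => capPullback q a (f i) (v i)) l (𝓝 y) := by
  have hdensity : Tendsto (fun i => ‖(q : E) + v i‖⁻¹ ^ Module.finrank ℝ E) l (𝓝 1) := by
    have hcont : Continuous fun v : (ℝ ∙ (q : E))ᗮ => ‖(q : E) + v‖⁻¹ ^ Module.finrank ℝ E :=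
      (Continuous.inv₀ (by fun_prop) fun v => (norm_add_tangent_pos q v).ne').pow _
    simpa [Function.comp_def] using (hcont.tendsto 0).comp hv
  have hlim := hdensity.smul hf
  rw [one_smul] at hlim
  refine hlim.congr' ?_
  filter_upwards [(tendsto_gnomonic q hv).eventually (sphericalCap_mem_nhds q ha)] with i hi
  rw [capPullback, Set.indicator_of_mem (show v i ∈ gnomonic q ⁻¹' sphericalCap q a from hi)]

variable [FiniteDimensional ℝ E] [MeasurableSpace E] [BorelSpace E]

lemma integrable_exp_neg_mul_norm_sq {b : ℝ} (hb : 0 < b) :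
    Integrable (fun v : E => Real.exp (-b * ‖v‖ ^ 2)) := by
  refine (GaussianFourier.integrable_cexp_neg_mul_sq_norm_add (V := E) (b := (b : ℂ))
    (by simpa using hb) 0 0).norm.congr (ae_of_all _ fun v => ?_)
  simp [Complex.norm_exp, ← Complex.ofReal_pow]

lemma integral_sphericalCap (q : sphere (0 : E) 1) {a : ℝ} (ha : 0 ≤ a)
    (f : sphere (0 : E) 1 → F) :
    ∫ x in sphericalCap q a, f x ∂(volume : Measure E).toSphere =
      ∫ v in gnomonic q ⁻¹' sphericalCap q a,
        ‖(q : E) + v‖⁻¹ ^ Module.finrank ℝ E • f (gnomonic q v) := by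
  have hsub : sphericalCap q a ⊆ sphericalCap q 0 := fun x hx => ha.trans_lt hx
  have hgn := measurableEmbedding_gnomonic q
  have hcap := (isOpen_sphericalCap q a).measurableSet
  rw [← Measure.restrict_restrict_of_subset hsub, toSphere_restrict_hemisphere, hgn.setIntegral_map]
  simp only [ENNReal.ofReal]
  rw [setIntegral_withDensity_eq_setIntegral_smul (by fun_prop) _ (hgn.measurable hcap)]
  refine integral_congr_ae (ae_of_all _ fun v => ?_)
  simp only [NNReal.smul_def]
  rw [Real.coe_toNNReal _ (by positivity)]

lemma stronglyMeasurable_capPullback (q : sphere (0 : E) 1) (a : ℝ) {f : sphere (0 : E) 1 → F}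
    (hf : StronglyMeasurable f) : StronglyMeasurable (capPullback q a f) := by
  have hgn := (measurableEmbedding_gnomonic q).measurable
  exact (StronglyMeasurable.smul (Measurable.stronglyMeasurable (by fun_prop))
    (hf.comp_measurable hgn)).indicator (hgn (isOpen_sphericalCap q a).measurableSet)

lemma pow_smul_integral_sphericalCap (q : sphere (0 : E) 1) {a : ℝ} (ha : 0 ≤ a)
    (f : sphere (0 : E) 1 → F) {s : ℝ} (hs : 0 < s) :
    s ^ Module.finrank ℝ (ℝ ∙ (q : E))ᗮ •
        ∫ x in sphericalCap q a, f x ∂(volume : Measure E).toSphere =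
      ∫ w, capPullback q a f (s⁻¹ • w) := by
  have hcap := (isOpen_sphericalCap q a).measurableSet
  rw [integral_sphericalCap q ha, Measure.integral_comp_smul, inv_pow, inv_inv,
    abs_of_pos (by positivity), capPullback,
    integral_indicator ((measurableEmbedding_gnomonic q).measurable hcap)]

lemma tendsto_integral_sphericalCap [l.IsCountablyGenerated] (q : sphere (0 : E) 1) {a C c : ℝ}
    (ha : 0 < a) (ha1 : a < 1) (hC : 0 ≤ C) (hc : 0 < c) {β : ι → ℝ} (hβ : Tendsto β l atTop)
    {f : ι → sphere (0 : E) 1 → F} (hf : ∀ i, StronglyMeasurable (f i))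
    (hbound : ∀ᶠ i in l, ∀ x ∈ sphericalCap q a,
      ‖f i x‖ ≤ C * Real.exp (-c * (β i * (1 - ⟪(q : E), (x : E)⟫))))
    {G : (ℝ ∙ (q : E))ᗮ → F}
    (hlim : ∀ᵐ v, Tendsto (fun i => f i (gnomonic q ((√(β i))⁻¹ • v))) l (𝓝 (G v))) :
    Tendsto (fun i => √(β i) ^ Module.finrank ℝ (ℝ ∙ (q : E))ᗮ •
      ∫ x in sphericalCap q a, f i x ∂(volume : Measure E).toSphere) l (𝓝 (∫ v, G v)) := by
  have hβ0 : ∀ᶠ i in l, 0 < β i := hβ.eventually_gt_atTop 0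
  have hchart : Tendsto (fun i => ∫ w, capPullback q a (f i) ((√(β i))⁻¹ • w)) l
      (𝓝 (∫ v, G v)) := by
    refine tendsto_integral_filter_of_dominated_convergence _
      (Eventually.of_forall fun i => ((stronglyMeasurable_capPullback q a (hf i)).comp_measurable
        (measurable_const_smul _)).aestronglyMeasurable)
      ?_ ((integrable_exp_neg_mul_norm_sq (b := c * (a ^ 2 / 2)) (by positivity)).const_mul C) ?_
    · filter_upwards [hbound, hβ0] with i hi hi0
      exact ae_of_all _ (norm_capPullback_inv_sqrt_smul_le q ha hi0 hC hc hi)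
    · filter_upwards [hlim] with v hv
      exact tendsto_capPullback q ha1 (tendsto_inv_sqrt_smul hβ v) hv
  refine hchart.congr' ?_
  filter_upwards [hβ0] with i hi
  exact (pow_smul_integral_sphericalCap q ha.le (f i) (Real.sqrt_pos.2 hi)).symm

lemma tendsto_sqrt_pow_mul_exp_neg_mul (k : ℕ) {b : ℝ} (hb : 0 < b) :
    Tendsto (fun t : ℝ => √t ^ k * Real.exp (-b * t)) atTop (𝓝 0) := by
  refine (tendsto_rpow_mul_exp_neg_mul_atTop_nhds_zero ((k : ℝ) / 2) b hb).congr' ?_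
  filter_upwards [eventually_ge_atTop 0] with t ht
  rw [Real.sqrt_eq_rpow, ← Real.rpow_natCast, ← Real.rpow_mul ht]
  ring_nf

lemma tendsto_integral_compl_sphericalCap (q : sphere (0 : E) 1) (k : ℕ) {a C c : ℝ} (ha : a < 1)
    (hC : 0 ≤ C) (hc : 0 < c) {β : ι → ℝ} (hβ : Tendsto β l atTop) {ρ : sphere (0 : E) 1 → ℝ}
    (hρ : Integrable ρ (volume : Measure E).toSphere) {g : ι → sphere (0 : E) 1 → F}
    (hbound : ∀ᶠ i in l, ∀ x,
      ‖g i x‖ ≤ C * Real.exp (-c * (β i * (1 - ⟪(q : E), (x : E)⟫)))) :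
    Tendsto (fun i => √(β i) ^ k •
      ∫ x in (sphericalCap q a)ᶜ, ρ x • g i x ∂(volume : Measure E).toSphere) l (𝓝 0) := by
  set I := ∫ x, ‖ρ x‖ ∂(volume : Measure E).toSphere
  have hlim : Tendsto (fun i => √(β i) ^ k * Real.exp (-(c * (1 - a)) * β i) * (C * I)) l
      (𝓝 0) := by
    simpa using ((tendsto_sqrt_pow_mul_exp_neg_mul k
      (mul_pos hc (sub_pos.2 ha))).comp hβ).mul_const (C * I)
  refine squeeze_zero_norm' ?_ hlim
  filter_upwards [hbound, hβ.eventually_ge_atTop 0] with i hi hi0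
  have hfar (x : sphere (0 : E) 1) (hx : x ∈ (sphericalCap q a)ᶜ) :
      ‖ρ x • g i x‖ ≤ ‖ρ x‖ * (C * Real.exp (-(c * (1 - a)) * β i)) := by
    have hx' : ⟪(q : E), (x : E)⟫ ≤ a := not_lt.1 hx
    rw [norm_smul]
    refine mul_le_mul_of_nonneg_left ((hi x).trans ?_) (norm_nonneg _)
    rw [neg_mul, neg_mul, mul_assoc, mul_comm (1 - a)]
    gcongr
  have hint : ‖∫ x in (sphericalCap q a)ᶜ, ρ x • g i x ∂(volume : Measure E).toSphere‖ ≤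
      I * (C * Real.exp (-(c * (1 - a)) * β i)) := by
    refine (norm_integral_le_of_norm_le (hρ.norm.mul_const _).integrableOn
      ((ae_restrict_mem (isOpen_sphericalCap q a).measurableSet.compl).mono hfar)).trans ?_
    rw [integral_mul_const]
    gcongr
    exact setIntegral_le_integral hρ.norm (ae_of_all _ fun x => norm_nonneg _)
  rw [norm_smul, Real.norm_of_nonneg (by positivity)]
  calc _ ≤ √(β i) ^ k * (I * (C * Real.exp (-(c * (1 - a)) * β i))) := by gcongr
    _ = _ := by ring

/-- Laplace's method in the gnomonic chart: outside a fixed cap the integrals are exponentially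
small in `β`, and inside it `hbound` gives a Gaussian majorant for dominated convergence. -/
theorem tendsto_integral_sphere_localization [l.IsCountablyGenerated] (q : sphere (0 : E) 1)
    {ρ : sphere (0 : E) 1 → ℝ} (hρ : Measurable ρ)
    (hρi : Integrable ρ (volume : Measure E).toSphere) (hρc : ContinuousAt ρ q) {β : ι → ℝ}
    (hβ : Tendsto β l atTop) {g : ι → sphere (0 : E) 1 → F} (hg : ∀ i, StronglyMeasurable (g i))
    {C c : ℝ} (hC : 0 ≤ C) (hc : 0 < c)
    (hbound : ∀ᶠ i in l, ∀ x,
      ‖g i x‖ ≤ C * Real.exp (-c * (β i * (1 - ⟪(q : E), (x : E)⟫))))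
    {G : (ℝ ∙ (q : E))ᗮ → F}
    (hlim : ∀ᵐ v, Tendsto (fun i => g i (gnomonic q ((√(β i))⁻¹ • v))) l (𝓝 (G v))) :
    Tendsto (fun i => √(β i) ^ Module.finrank ℝ (ℝ ∙ (q : E))ᗮ •
      ∫ x, ρ x • g i x ∂(volume : Measure E).toSphere) l (𝓝 (ρ q • ∫ v, G v)) := by
  obtain ⟨a, ha, ha1, hcap⟩ := exists_sphericalCap_subset q
    (hρc.norm.eventually_lt_const (lt_add_one ‖ρ q‖))
  have hnear := tendsto_integral_sphericalCap q ha ha1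
    (mul_nonneg (by positivity : 0 ≤ ‖ρ q‖ + 1) hC) hc hβ
    (f := fun i x => ρ x • g i x) (G := fun v => ρ q • G v)
    (fun i => hρ.stronglyMeasurable.smul (hg i))
    (hbound.mono fun i hi x hx => by
      rw [norm_smul, mul_assoc]
      gcongr
      exacts [(hcap hx).le, hi x])
    (hlim.mono fun v hv =>
      (hρc.tendsto.comp (tendsto_gnomonic q (tendsto_inv_sqrt_smul hβ v))).smul hv)
  have hfar := tendsto_integral_compl_sphericalCap q (Module.finrank ℝ (ℝ ∙ (q : E))ᗮ) ha1 hC hc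
    hβ hρi hbound
  have hsum := hnear.add hfar
  rw [add_zero, integral_smul] at hsum
  refine hsum.congr' ?_
  filter_upwards [hbound, hβ.eventually_ge_atTop 0] with i hi hi0
  have hgC (x : sphere (0 : E) 1) : ‖g i x‖ ≤ C := by
    have := mul_nonneg hc.le (mul_nonneg hi0 (sub_nonneg.2 (inner_le_one_of_mem_sphere q x)))
    exact (hi x).trans (mul_le_of_le_one_right hC (Real.exp_le_one_iff.2 (by linarith)))
  have hint : Integrable (fun x => ρ x • g i x) (volume : Measure E).toSphere :=
    hρi.smul_bdd C (hg i).aestronglyMeasurable (ae_of_all _ hgC)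
  rw [← smul_add, integral_add_compl (isOpen_sphericalCap q a).measurableSet hint]

end Localization

/-! ### Polar coordinates and the critical intensity -/

section Polar

/-- The map `s ↦ s² / 2` from the open to the closed half-line. -/
def halfSq (s : Set.Ioi (0 : ℝ)) : ℝ≥0 := ⟨(s : ℝ) ^ 2 / 2, by positivity⟩

lemma coe_halfSq (s : Set.Ioi (0 : ℝ)) : (halfSq s : ℝ) = (s : ℝ) ^ 2 / 2 := rfl

lemma measurable_halfSq : Measurable halfSq :=
  Measurable.subtype_mk (by fun_prop)

lemma halfSq_preimage_Iio {a : ℝ≥0} (ha : 0 < √(2 * (a : ℝ))) :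
    halfSq ⁻¹' Set.Iio a = Set.Iio ⟨√(2 * (a : ℝ)), ha⟩ := by
  ext s
  rw [Set.mem_preimage, Set.mem_Iio, Set.mem_Iio, ← Subtype.coe_lt_coe, ← NNReal.coe_lt_coe,
    Real.lt_sqrt s.2.le, coe_halfSq, div_lt_iff₀ two_pos, mul_comm]

lemma map_halfSq_volumeIoiPow_Iio (n : ℕ) (a : ℝ≥0) :
    (Measure.volumeIoiPow n).map halfSq (Set.Iio a) =
      ENNReal.ofReal ((2 * a) ^ (((n : ℝ) + 1) / 2) / (n + 1)) := by
  rw [Measure.map_apply measurable_halfSq measurableSet_Iio]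
  rcases eq_zero_or_pos a with rfl | ha
  · simp [Real.zero_rpow (show ((n : ℝ) + 1) / 2 ≠ 0 by positivity)]
  · rw [halfSq_preimage_Iio (Real.sqrt_pos.2 (by positivity)), Measure.volumeIoiPow_apply_Iio]
    dsimp only
    rw [Real.sqrt_eq_rpow, ← Real.rpow_natCast, ← Real.rpow_mul (by positivity), Nat.cast_add_one,
      one_div_mul_eq_div]

lemma lintegral_Ioc_two_mul_rpow {p a : ℝ} (hp : -1 < p) (ha : 0 ≤ a) :
    ∫⁻ y in Set.Ioc 0 a, ENNReal.ofReal ((2 * y) ^ p) =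
      ENNReal.ofReal ((2 * a) ^ (p + 1) / (2 * (p + 1))) := by
  have hint : IntervalIntegrable (fun y : ℝ => (2 * y) ^ p) volume 0 a := by
    simpa using (intervalIntegral.intervalIntegrable_rpow' hp (a := 0) (b := 2 * a)).comp_mul_left
      (c := 2)
  rw [← ofReal_integral_eq_lintegral_ofReal hint.1, ← intervalIntegral.integral_of_le ha,
    intervalIntegral.integral_comp_mul_left (fun y => y ^ p) two_ne_zero,
    integral_rpow (Or.inl hp), mul_zero, Real.zero_rpow (by linarith), sub_zero, smul_eq_mul,
    ← div_eq_inv_mul, div_div, mul_comm (p + 1)]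
  filter_upwards [ae_restrict_mem measurableSet_Ioc] with y hy
  exact Real.rpow_nonneg (mul_nonneg two_pos.le hy.1.le) _

lemma setLIntegral_comap_nnreal_Iio (f : ℝ → ℝ≥0∞) (a : ℝ≥0) :
    ∫⁻ y in Set.Iio a, f y ∂((volume : Measure ℝ).comap ((↑) : ℝ≥0 → ℝ)) =
      ∫⁻ y in Set.Ioc 0 (a : ℝ), f y := by
  have hemb : MeasurableEmbedding ((↑) : ℝ≥0 → ℝ) :=
    MeasurableEmbedding.subtype_coe measurableSet_Ici
  have himage : ((↑) : ℝ≥0 → ℝ) '' Set.Iio a = Set.Ico 0 (a : ℝ) := by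
    ext x
    exact ⟨fun ⟨y, hy, hyx⟩ => hyx ▸ ⟨y.2, hy⟩, fun hx => ⟨⟨x, hx.1⟩, hx.2, rfl⟩⟩
  rw [hemb.restrict_comap, ← hemb.lintegral_map, hemb.map_comap,
    Measure.restrict_restrict hemb.measurableSet_range,
    Set.inter_eq_right.2 (Set.image_subset_range _ _), himage,
    Measure.restrict_congr_set Ico_ae_eq_Ioc]

lemma map_halfSq_volumeIoiPow (n : ℕ) :
    (Measure.volumeIoiPow n).map halfSq =
      ((volume : Measure ℝ).comap ((↑) : ℝ≥0 → ℝ)).withDensity fun y =>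
        ENNReal.ofReal ((2 * (y : ℝ)) ^ (((n : ℝ) + 1) / 2 - 1)) := by
  have hIio (a : ℝ≥0) : (Measure.volumeIoiPow n).map halfSq (Set.Iio a) =
      ((volume : Measure ℝ).comap ((↑) : ℝ≥0 → ℝ)).withDensity (fun y =>
        ENNReal.ofReal ((2 * (y : ℝ)) ^ (((n : ℝ) + 1) / 2 - 1))) (Set.Iio a) := by
    have hp : -1 < ((n : ℝ) + 1) / 2 - 1 := by linarith [(by positivity : 0 < ((n : ℝ) + 1) / 2)]
    rw [map_halfSq_volumeIoiPow_Iio, withDensity_apply _ measurableSet_Iio,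
      setLIntegral_comap_nnreal_Iio
        (fun y => ENNReal.ofReal ((2 * y) ^ (((n : ℝ) + 1) / 2 - 1))),
      lintegral_Ioc_two_mul_rpow hp a.coe_nonneg, sub_add_cancel, mul_div_cancel₀ _ two_ne_zero]
  refine Measure.ext_of_generateFrom_of_iUnion (Set.range Set.Iio) (fun k : ℕ => Set.Iio (k : ℝ≥0))
    ((BorelSpace.measurable_eq (α := ℝ≥0)).trans (borel_eq_generateFrom_Iio _)) isPiSystem_Iio
    (Set.iUnion_eq_univ_iff.2 exists_nat_gt) (fun k => ⟨_, rfl⟩) (fun k => ?_) ?_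
  · rw [map_halfSq_volumeIoiPow_Iio]
    exact ENNReal.ofReal_ne_top
  · rintro _ ⟨a, rfl⟩
    exact hIio a

variable {V : Type*} [NormedAddCommGroup V] [NormedSpace ℝ V]

/-- The map sending a nonzero tangent vector `w` to `(‖w‖² / 2, w / ‖w‖)`. -/
def tangentPolar (w : ({0}ᶜ : Set V)) : ℝ≥0 × sphere (0 : V) 1 :=
  (halfSq (homeomorphUnitSphereProd V w).2, (homeomorphUnitSphereProd V w).1)

lemma coe_tangentPolar_fst (w : ({0}ᶜ : Set V)) :
    ((tangentPolar w).1 : ℝ) = ‖(w : V)‖ ^ 2 / 2 := by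
  simp [tangentPolar, coe_halfSq]

lemma coe_tangentPolar_snd (w : ({0}ᶜ : Set V)) :
    ((tangentPolar w).2 : V) = ‖(w : V)‖⁻¹ • (w : V) := by
  simp [tangentPolar]

variable [MeasurableSpace V] [BorelSpace V]

lemma measurable_tangentPolar : Measurable (tangentPolar (V := V)) := by
  have h := (homeomorphUnitSphereProd V).measurable
  exact (measurable_halfSq.comp h.snd).prodMk h.fst

lemma map_tangentPolar [FiniteDimensional ℝ V] (μ : Measure V) [μ.IsAddHaarMeasure] :
    (μ.comap ((↑) : ({0}ᶜ : Set V) → V)).map tangentPolar =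
      ((Measure.volumeIoiPow (Module.finrank ℝ V - 1)).map halfSq).prod μ.toSphere := by
  have hpolar := μ.measurePreserving_homeomorphUnitSphereProd
  have hcomp : (tangentPolar (V := V)) = Prod.map halfSq id ∘ Prod.swap ∘
      homeomorphUnitSphereProd V := rfl
  have : SFinite ((Measure.volumeIoiPow (Module.finrank ℝ V - 1)).map halfSq) := inferInstance
  rw [hcomp, ← Measure.map_map (measurable_halfSq.prodMap measurable_id)
    (measurable_swap.comp hpolar.measurable), ← Measure.map_map measurable_swap hpolar.measurable,
    hpolar.map_eq, Measure.prod_swap, ← Measure.map_prod_map _ _ measurable_halfSq measurable_id,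
    Measure.map_id]

end Polar

section CriticalIntensity

variable {d : ℕ}

lemma one_div_alphaExp {d : ℕ} (hd : 2 ≤ d) : 1 / alphaExp d = ((d - 1 : ℕ) : ℝ) / 2 := by
  rw [alphaExp, Nat.cast_sub (by omega), one_div_div, Nat.cast_one]

lemma alphaExp_pos (hd : 2 ≤ d) : 0 < alphaExp d := by
  have : (2 : ℝ) ≤ d := by exact_mod_cast hd
  exact div_pos two_pos (by linarith)

lemma finrank_tangentAt (q : USphere d) : Module.finrank ℝ (tangentAt q) = d - 1 := by
  have h : Module.finrank ℝ (tangentAt q) + 1 = d :=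
    (finrank_tangent_add_one q).trans finrank_euclideanSpace_fin
  omega

lemma nontrivial_tangentAt (hd : 2 ≤ d) (q : USphere d) : Nontrivial (tangentAt q) :=
  Module.nontrivial_of_finrank_pos (R := ℝ) (by rw [finrank_tangentAt q]; omega)

instance isFiniteMeasure_surfaceMeasure (F : Type*) [NormedAddCommGroup F] [InnerProductSpace ℝ F]
    [FiniteDimensional ℝ F] [MeasurableSpace F] [BorelSpace F] :
    IsFiniteMeasure (surfaceMeasure F) := by
  unfold surfaceMeasure
  infer_instance

lemma surfaceMeasure_tangentAt_univ (hd : 2 ≤ d) (q : USphere d) :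
    surfaceMeasure (tangentAt q) Set.univ = ENNReal.ofReal
      ((surfaceMeasure (EuclideanSpace ℝ (Fin (d - 1)))).real Set.univ) := by
  have := nontrivial_tangentAt hd q
  have : Nontrivial (EuclideanSpace ℝ (Fin (d - 1))) :=
    Module.nontrivial_of_finrank_pos (R := ℝ) (by rw [finrank_euclideanSpace_fin]; omega)
  rw [ofReal_measureReal, surfaceMeasure, surfaceMeasure, Measure.toSphere_apply_univ,
    Measure.toSphere_apply_univ, InnerProductSpace.volume_ball, InnerProductSpace.volume_ball,
    finrank_tangentAt q, finrank_euclideanSpace_fin]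

lemma criticalDensity_eq (hd : 2 ≤ d) {γ : ℝ} (hγ : 0 < γ) (r : ℝ) (y : ℝ≥0) :
    localIntensity d r / (alphaExp d * γ ^ (1 / alphaExp d)) * (y : ℝ) ^ (1 / alphaExp d - 1) =
      γ ^ (-(1 / alphaExp d)) * r *
        (surfaceMeasure (EuclideanSpace ℝ (Fin (d - 1)))).real Set.univ *
        (2 * (y : ℝ)) ^ (1 / alphaExp d - 1) := by
  have hd1 : (d : ℝ) - 1 ≠ 0 := by
    have : (2 : ℝ) ≤ d := by exact_mod_cast hd
    linarith
  have hα : 2 / ((d : ℝ) - 1) = alphaExp d := rfl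
  have := (Real.rpow_pos_of_pos hγ (1 / alphaExp d)).ne'
  rw [localIntensity, Real.mul_rpow two_pos.le y.coe_nonneg, Real.rpow_sub_one two_ne_zero,
    Real.rpow_neg hγ.le, ← hα]
  field_simp

lemma criticalIntensity_eq_smul_map_tangentPolar (hd : 2 ≤ d) (q : USphere d) {γ r : ℝ}
    (hγ : 0 < γ) (hr : 0 ≤ r) :
    criticalIntensity q γ r = ENNReal.ofReal (γ ^ (-(1 / alphaExp d)) * r) •
      ((volume : Measure (tangentAt q)).comap ((↑) : ({0}ᶜ : Set (tangentAt q)) → _)).map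
        tangentPolar := by
  set σ := (surfaceMeasure (EuclideanSpace ℝ (Fin (d - 1)))).real Set.univ
  have hσ0 : ENNReal.ofReal σ ≠ 0 := by
    have := nontrivial_tangentAt hd q
    rw [← surfaceMeasure_tangentAt_univ hd q, Ne, Measure.measure_univ_eq_zero]
    exact Measure.toSphere_ne_zero _
  have hexp : ((d - 1 - 1 : ℕ) + 1 : ℝ) / 2 = 1 / alphaExp d := by
    rw [one_div_alphaExp hd, ← Nat.cast_add_one, Nat.sub_add_cancel (by omega)]
  have hdensity : (fun y : ℝ≥0 => ENNReal.ofReal (localIntensity d r /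
      (alphaExp d * γ ^ (1 / alphaExp d)) * (y : ℝ) ^ (1 / alphaExp d - 1))) =
      ENNReal.ofReal (γ ^ (-(1 / alphaExp d)) * r * σ) •
        fun y : ℝ≥0 => ENNReal.ofReal ((2 * (y : ℝ)) ^ (1 / alphaExp d - 1)) := by
    ext y
    rw [criticalDensity_eq hd hγ, ENNReal.ofReal_mul (by positivity), Pi.smul_apply, smul_eq_mul]
  rw [criticalIntensity, uniformTangent, surfaceMeasure_tangentAt_univ hd q, map_tangentPolar,
    finrank_tangentAt q, map_halfSq_volumeIoiPow, hexp, hdensity,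
    withDensity_smul _ (by fun_prop), Measure.prod_smul_left, Measure.prod_smul_right, smul_smul,
    ENNReal.ofReal_mul (by positivity), mul_assoc, ENNReal.mul_inv_cancel hσ0
      ENNReal.ofReal_ne_top, mul_one]
  rfl

lemma continuous_criticalNumer (q : USphere d) : Continuous (criticalNumer q) := by
  unfold criticalNumer
  fun_prop

lemma continuous_criticalDenom (q : USphere d) : Continuous (criticalDenom q) := by
  unfold criticalDenom
  fun_prop

lemma criticalDenom_tangentPolar (q : USphere d) (w : ({0}ᶜ : Set (tangentAt q))) :
    criticalDenom q (tangentPolar w) = Real.exp (-(‖(w : tangentAt q)‖ ^ 2 / 2)) := by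
  rw [criticalDenom, coe_tangentPolar_fst]

lemma criticalNumer_tangentPolar (q : USphere d) (w : ({0}ᶜ : Set (tangentAt q))) :
    criticalNumer q (tangentPolar w) = Real.exp (-(‖(w : tangentAt q)‖ ^ 2 / 2)) •
      ((w : tangentAt q) : EuclideanSpace ℝ (Fin d)) := by
  have hw : ‖(w : tangentAt q)‖ ≠ 0 := norm_ne_zero_iff.2 w.2
  rw [criticalNumer, coe_tangentPolar_fst, coe_tangentPolar_snd, Submodule.coe_smul, smul_smul,
    mul_div_cancel₀ _ (two_ne_zero), Real.sqrt_sq (norm_nonneg _), mul_assoc,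
    mul_inv_cancel₀ hw, mul_one]

variable {F : Type*} [NormedAddCommGroup F]

lemma integrable_criticalIntensity (hd : 2 ≤ d) (q : USphere d) {γ r : ℝ} (hγ : 0 < γ)
    (hr : 0 ≤ r) {H : ℝ≥0 × TangentSphere q → F} (hH : StronglyMeasurable H) {G : tangentAt q → F}
    (hG : ∀ w : ({0}ᶜ : Set (tangentAt q)), H (tangentPolar w) = G w)
    (hi : Integrable G volume) : Integrable H (criticalIntensity q γ r) := by
  rw [criticalIntensity_eq_smul_map_tangentPolar hd q hγ hr]
  refine Integrable.smul_measure ?_ ENNReal.ofReal_ne_top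
  rw [integrable_map_measure hH.aestronglyMeasurable measurable_tangentPolar.aemeasurable]
  have hcomp : H ∘ tangentPolar = G ∘ ((↑) : ({0}ᶜ : Set (tangentAt q)) → tangentAt q) :=
    funext hG
  rw [hcomp, ← integrableOn_iff_comap_subtypeVal (measurableSet_singleton _).compl]
  exact hi.integrableOn

lemma integral_criticalIntensity [NormedSpace ℝ F] (hd : 2 ≤ d) (q : USphere d) {γ r : ℝ}
    (hγ : 0 < γ) (hr : 0 ≤ r) {H : ℝ≥0 × TangentSphere q → F} (hH : StronglyMeasurable H)
    {G : tangentAt q → F} (hG : ∀ w : ({0}ᶜ : Set (tangentAt q)), H (tangentPolar w) = G w) :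
    ∫ z, H z ∂(criticalIntensity q γ r) = (γ ^ (-(1 / alphaExp d)) * r) • ∫ w, G w := by
  have := nontrivial_tangentAt hd q
  rw [criticalIntensity_eq_smul_map_tangentPolar hd q hγ hr, integral_smul_measure, integral_map
    measurable_tangentPolar.aemeasurable hH.aestronglyMeasurable,
    ENNReal.toReal_ofReal (by positivity)]
  simp_rw [hG]
  rw [integral_subtype_comap (measurableSet_singleton _).compl, restrict_compl_singleton]

lemma criticalIntensity_fst_lt_ne_top (hd : 2 ≤ d) (q : USphere d) {γ r : ℝ} (hγ : 0 < γ)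
    (hr : 0 ≤ r) (a : ℝ≥0) : criticalIntensity q γ r {z | z.1 < a} ≠ ∞ := by
  have hS : MeasurableSet {z : ℝ≥0 × TangentSphere q | z.1 < a} :=
    measurableSet_lt measurable_fst measurable_const
  rw [criticalIntensity_eq_smul_map_tangentPolar hd q hγ hr, Measure.smul_apply, Measure.map_apply
    measurable_tangentPolar hS, smul_eq_mul, comap_subtype_coe_apply
    (measurableSet_singleton _).compl]
  refine ENNReal.mul_ne_top ENNReal.ofReal_ne_top ?_
  refine ((measure_mono ?_).trans_lt (measure_ball_lt_top (μ := (volume : Measure (tangentAt q)))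
    (x := 0) (r := 2 * (a : ℝ) + 1))).ne
  rintro _ ⟨w, hw, rfl⟩
  have hnorm : ‖(w : tangentAt q)‖ ^ 2 / 2 < a := coe_tangentPolar_fst w ▸ NNReal.coe_lt_coe.2 hw
  rw [mem_ball_zero_iff]
  nlinarith [norm_nonneg (w : tangentAt q), sq_nonneg (‖(w : tangentAt q)‖ - 1)]

lemma criticalIntensity_univ (hd : 2 ≤ d) (q : USphere d) {γ r : ℝ} (hγ : 0 < γ)
    (hr : 0 < r) : criticalIntensity q γ r Set.univ = ∞ := by
  have := nontrivial_tangentAt hd q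
  have : NoncompactSpace (tangentAt q) := NormedSpace.noncompactSpace ℝ _
  rw [criticalIntensity_eq_smul_map_tangentPolar hd q hγ hr.le, Measure.smul_apply,
    Measure.map_apply measurable_tangentPolar .univ, smul_eq_mul, comap_subtype_coe_apply
    (measurableSet_singleton _).compl, Set.preimage_univ, Set.image_univ, Subtype.range_coe,
    measure_compl (measurableSet_singleton _) (by simp), measure_univ_of_isAddLeftInvariant]
  rw [measure_singleton, tsub_zero]
  exact ENNReal.mul_top (ENNReal.ofReal_pos.2 (by positivity)).ne'

lemma sigmaFinite_criticalIntensity (hd : 2 ≤ d) (q : USphere d) {γ r : ℝ} (hγ : 0 < γ)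
    (hr : 0 ≤ r) : SigmaFinite (criticalIntensity q γ r) :=
  ⟨⟨{ set := fun k => {z | z.1 < (k : ℝ≥0)}
      set_mem := fun _ => trivial
      finite := fun k => (criticalIntensity_fst_lt_ne_top hd q hγ hr k).lt_top
      spanning := Set.iUnion_eq_univ_iff.2 fun z => exists_nat_gt z.1 }⟩⟩

lemma exists_poissonPointProcess_criticalIntensity (hd : 2 ≤ d) (q : USphere d) {γ r : ℝ}
    (hγ : 0 < γ) (hr : 0 ≤ r) :
    ∃ (Ω₀ : Type) (_ : MeasurableSpace Ω₀) (P₀ : Measure Ω₀) (_ : IsProbabilityMeasure P₀)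
      (M : Ω₀ → Measure (ℝ≥0 × TangentSphere q)),
      IsPoissonPointProcess P₀ (criticalIntensity q γ r) M := by
  have := nontrivial_tangentAt hd q
  have : Nonempty (TangentSphere q) := (NormedSpace.sphere_nonempty.2 zero_le_one).to_subtype
  refine ⟨_, _, exists_isPoissonPointProcess _ (S := fun k => {z | ⌊z.1⌋₊ = k}) (fun k => ?_)
    (fun i j hij => ?_) ?_ (fun k => ?_) (fun B hB => ?_)⟩
  · exact (Nat.measurable_floor.comp measurable_fst) (measurableSet_singleton k)
  · exact Set.disjoint_left.2 fun z hz hz' => hij (hz.symm.trans hz')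
  · exact Set.iUnion_eq_univ_iff.2 fun z => ⟨_, rfl⟩
  · refine measure_ne_top_of_subset ?_ (criticalIntensity_fst_lt_ne_top hd q hγ hr (k + 1))
    rintro z (rfl : ⌊z.1⌋₊ = k)
    exact Nat.lt_floor_add_one z.1
  · obtain ⟨R, hR⟩ := hB.image_fst.subset_closedBall 0
    refine ⟨⌊R⌋₊ + 1, fun k hk => Set.disjoint_left.2 ?_⟩
    rintro z hz (rfl : ⌊z.1⌋₊ = k)
    have hzR : (z.1 : ℝ) ≤ R := by
      simpa only [mem_closedBall, NNReal.dist_eq, NNReal.coe_zero, sub_zero, NNReal.abs_eq]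
        using hR (Set.mem_image_of_mem _ hz)
    have hfloor : (⌊z.1⌋₊ : ℝ) ≤ z.1 := by exact_mod_cast Nat.floor_le z.1.2
    exact (Nat.le_floor (hfloor.trans hzR)).not_gt hk

lemma integrable_exp_neg_norm_sq_smul {V W : Type*} [NormedAddCommGroup V]
    [InnerProductSpace ℝ V] [FiniteDimensional ℝ V] [MeasurableSpace V] [BorelSpace V]
    [NormedAddCommGroup W] [NormedSpace ℝ W] (L : V →L[ℝ] W) :
    Integrable (fun w : V => Real.exp (-(‖w‖ ^ 2 / 2)) • L w) := by
  refine ((integrable_exp_neg_mul_norm_sq (E := V) (b := 1 / 4) (by norm_num)).const_mul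
    (2 * ‖L‖)).mono' (Continuous.aestronglyMeasurable (by fun_prop)) (ae_of_all _ fun w => ?_)
  rw [norm_smul, Real.norm_of_nonneg (Real.exp_pos _).le]
  have hw : ‖w‖ ≤ 2 * Real.exp (1 / 4 * ‖w‖ ^ 2) := by
    nlinarith [Real.add_one_le_exp (1 / 4 * ‖w‖ ^ 2), sq_nonneg (‖w‖ - 1)]
  calc Real.exp (-(‖w‖ ^ 2 / 2)) * ‖L w‖
      ≤ Real.exp (-(‖w‖ ^ 2 / 2)) * (‖L‖ * (2 * Real.exp (1 / 4 * ‖w‖ ^ 2))) := by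
        gcongr
        exact (L.le_opNorm w).trans (by gcongr)
    _ = 2 * ‖L‖ * (Real.exp (-(‖w‖ ^ 2 / 2)) * Real.exp (1 / 4 * ‖w‖ ^ 2)) := by ring
    _ = _ := by
        rw [← Real.exp_add]
        ring_nf

lemma integrable_criticalNumer (hd : 2 ≤ d) (q : USphere d) {γ r : ℝ} (hγ : 0 < γ)
    (hr : 0 ≤ r) : Integrable (criticalNumer q) (criticalIntensity q γ r) :=
  integrable_criticalIntensity hd q hγ hr (continuous_criticalNumer q).stronglyMeasurable
    (criticalNumer_tangentPolar q) (integrable_exp_neg_norm_sq_smul (tangentAt q).subtypeL)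

lemma integrable_criticalDenom (hd : 2 ≤ d) (q : USphere d) {γ r : ℝ} (hγ : 0 < γ)
    (hr : 0 ≤ r) : Integrable (criticalDenom q) (criticalIntensity q γ r) := by
  refine integrable_criticalIntensity hd q hγ hr (continuous_criticalDenom q).stronglyMeasurable
    (G := fun w => Real.exp (-(‖w‖ ^ 2 / 2))) (criticalDenom_tangentPolar q) ?_
  refine (integrable_exp_neg_mul_norm_sq (b := 1 / 2) (by norm_num)).congr (ae_of_all _ fun w => ?_)
  ring_nf

end CriticalIntensity

section Scaling

variable {d : ℕ}

lemma norm_sub_sq_eq_distToQuery (q x : USphere d) :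
    ‖(x : EuclideanSpace ℝ (Fin d)) - q‖ ^ 2 = 2 * distToQuery q x := by
  rw [norm_sub_sq_real, real_inner_comm, distToQuery, norm_eq_of_mem_sphere,
    norm_eq_of_mem_sphere]
  ring

lemma continuous_distToQuery (q : USphere d) : Continuous (distToQuery q) := by
  unfold distToQuery
  fun_prop

lemma distToQuery_gnomonic (q : USphere d) (v : tangentAt q) :
    distToQuery q (gnomonic q v) = 1 - ‖(q : EuclideanSpace ℝ (Fin d)) + v‖⁻¹ := by
  rw [distToQuery, inner_gnomonic]

lemma distToQuery_gnomonic_eq_div (q : USphere d) (v : tangentAt q) :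
    distToQuery q (gnomonic q v) = ‖v‖ ^ 2 / (‖(q : EuclideanSpace ℝ (Fin d)) + v‖ *
      (‖(q : EuclideanSpace ℝ (Fin d)) + v‖ + 1)) := by
  have hpos := norm_add_tangent_pos q v
  rw [distToQuery_gnomonic, eq_sub_of_add_eq' (norm_add_tangent_sq q v).symm]
  field_simp
  ring

lemma coe_gnomonic_sub (q : USphere d) (v : tangentAt q) :
    (gnomonic q v : EuclideanSpace ℝ (Fin d)) - q =
      ‖(q : EuclideanSpace ℝ (Fin d)) + v‖⁻¹ • (v : EuclideanSpace ℝ (Fin d)) -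
        distToQuery q (gnomonic q v) • (q : EuclideanSpace ℝ (Fin d)) := by
  rw [coe_gnomonic, distToQuery_gnomonic]
  module

variable {ι : Type*} {l : Filter ι} {β : ι → ℝ}

lemma tendsto_norm_add_tangent (hβ : Tendsto β l atTop) (q : USphere d) (v : tangentAt q) :
    Tendsto (fun i => ‖(q : EuclideanSpace ℝ (Fin d)) + ((√(β i))⁻¹ • v : tangentAt q)‖) l
      (𝓝 1) := by
  have hcont : Continuous fun v : tangentAt q => ‖(q : EuclideanSpace ℝ (Fin d)) + v‖ := by
    fun_prop
  simpa [Function.comp_def] using (hcont.tendsto 0).comp (tendsto_inv_sqrt_smul hβ v)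

lemma tendsto_mul_distToQuery_gnomonic (hβ : Tendsto β l atTop) (q : USphere d)
    (v : tangentAt q) :
    Tendsto (fun i => β i * distToQuery q (gnomonic q ((√(β i))⁻¹ • v))) l (𝓝 (‖v‖ ^ 2 / 2)) := by
  have hN := tendsto_norm_add_tangent hβ q v
  have hquot := (tendsto_const_nhds (x := ‖v‖ ^ 2)).div (hN.mul (hN.add_const 1)) (by norm_num)
  rw [one_mul, one_add_one_eq_two] at hquot
  refine hquot.congr' ?_
  filter_upwards [hβ.eventually_gt_atTop 0] with i hi
  rw [Pi.div_apply, distToQuery_gnomonic_eq_div, norm_smul, norm_inv,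
    Real.norm_of_nonneg (Real.sqrt_nonneg _), mul_pow, inv_pow, Real.sq_sqrt hi.le, ← mul_div_assoc,
    mul_inv_cancel_left₀ hi.ne']

lemma tendsto_sqrt_smul_gnomonic_sub (hβ : Tendsto β l atTop) (q : USphere d)
    (v : tangentAt q) :
    Tendsto (fun i => √(β i) • ((gnomonic q ((√(β i))⁻¹ • v) : EuclideanSpace ℝ (Fin d)) - q)) l
      (𝓝 (v : EuclideanSpace ℝ (Fin d))) := by
  have htangent := ((tendsto_norm_add_tangent hβ q v).inv₀ one_ne_zero).smul_const
    (v : EuclideanSpace ℝ (Fin d))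
  have hnormal := ((tendsto_inv_atTop_zero.comp (Real.tendsto_sqrt_atTop.comp hβ)).mul
    (tendsto_mul_distToQuery_gnomonic hβ q v)).smul_const (q : EuclideanSpace ℝ (Fin d))
  have hlim := htangent.sub hnormal
  rw [inv_one, one_smul, zero_mul, zero_smul, sub_zero] at hlim
  refine hlim.congr' ?_
  filter_upwards [hβ.eventually_gt_atTop 0] with i hi
  have hs := (Real.sqrt_pos.2 hi).ne'
  have hsqrt : (√(β i))⁻¹ * β i = √(β i) := by
    rw [inv_mul_eq_div, Real.div_sqrt]
  rw [coe_gnomonic_sub, Function.comp_apply, Function.comp_apply, ← mul_assoc, hsqrt, smul_sub,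
    smul_smul, smul_smul, Submodule.coe_smul, smul_smul, mul_right_comm,
    mul_inv_cancel₀ hs, one_mul]

end Scaling

section LocalIntensity

variable {d : ℕ} {ρ : USphere d → ℝ}

lemma integral_densityLaw (hρ : Measurable ρ) (hρ0 : ∀ x, 0 ≤ ρ x)
    {F : Type*} [NormedAddCommGroup F] [NormedSpace ℝ F] (f : USphere d → F) :
    ∫ x, f x ∂(densityLaw ρ) = ∫ x, ρ x • f x ∂(surfaceMeasure (EuclideanSpace ℝ (Fin d))) := by
  rw [densityLaw, integral_withDensity_eq_integral_toReal_smul hρ.ennreal_ofReal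
    (ae_of_all _ fun _ => ENNReal.ofReal_lt_top)]
  simp_rw [ENNReal.toReal_ofReal (hρ0 _)]

lemma integrable_of_isFiniteMeasure_densityLaw (hρ : Measurable ρ) (hρ0 : ∀ x, 0 ≤ ρ x)
    [IsFiniteMeasure (densityLaw ρ)] :
    Integrable ρ (surfaceMeasure (EuclideanSpace ℝ (Fin d))) := by
  refine (lintegral_ofReal_ne_top_iff_integrable hρ.aestronglyMeasurable (ae_of_all _ hρ0)).1 ?_
  rw [← setLIntegral_univ, ← withDensity_apply _ .univ]
  exact measure_ne_top (densityLaw ρ) _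

lemma sqrt_pow_eq_rpow (hd : 2 ≤ d) {b : ℝ} (hb : 0 ≤ b) :
    √b ^ (d - 1) = b ^ (1 / alphaExp d) := by
  rw [one_div_alphaExp hd, Real.sqrt_eq_rpow, ← Real.rpow_natCast, ← Real.rpow_mul hb,
    one_div_mul_eq_div]

theorem tendsto_integral_densityLaw_localization (hd : 2 ≤ d) (q : USphere d)
    (hρ : Measurable ρ) (hρ0 : ∀ x, 0 ≤ ρ x) [IsFiniteMeasure (densityLaw ρ)]
    (hρc : ContinuousAt ρ q) {ι : Type*} {l : Filter ι} [l.IsCountablyGenerated] {β : ι → ℝ}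
    (hβ : Tendsto β l atTop) {F : Type*} [NormedAddCommGroup F] [NormedSpace ℝ F]
    {g : ι → USphere d → F} (hg : ∀ i, StronglyMeasurable (g i)) {C c : ℝ} (hC : 0 ≤ C) (hc : 0 < c)
    (hbound : ∀ᶠ i in l, ∀ x, ‖g i x‖ ≤ C * Real.exp (-c * (β i * distToQuery q x)))
    {G : tangentAt q → F}
    (hlim : ∀ᵐ v, Tendsto (fun i => g i (gnomonic q ((√(β i))⁻¹ • v))) l (𝓝 (G v))) :
    Tendsto (fun i => β i ^ (1 / alphaExp d) • ∫ x, g i x ∂(densityLaw ρ)) l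
      (𝓝 (ρ q • ∫ v, G v)) := by
  refine (tendsto_integral_sphere_localization q hρ
    (integrable_of_isFiniteMeasure_densityLaw hρ hρ0) hρc hβ hg hC hc hbound hlim).congr' ?_
  filter_upwards [hβ.eventually_ge_atTop 0] with i hi
  rw [integral_densityLaw hρ hρ0, finrank_tangentAt q, sqrt_pow_eq_rpow hd hi, surfaceMeasure]

lemma volume_real_closedBall_sqrt_two (hd : 2 ≤ d) (q : USphere d) :
    (volume : Measure (tangentAt q)).real (closedBall 0 (√2)) =
      2 ^ (1 / alphaExp d) * (surfaceMeasure (EuclideanSpace ℝ (Fin (d - 1)))).real Set.univ /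
        ((d : ℝ) - 1) := by
  have hd1 : (0 : ℝ) < (d : ℝ) - 1 := sub_pos.2 (by exact_mod_cast hd)
  have hsurface : (surfaceMeasure (EuclideanSpace ℝ (Fin (d - 1)))).real Set.univ =
      ((d : ℝ) - 1) * (volume : Measure (tangentAt q)).real (ball 0 1) := by
    rw [← ENNReal.toReal_ofReal measureReal_nonneg, ← surfaceMeasure_tangentAt_univ hd q,
      surfaceMeasure, ← Measure.real,
      Measure.toSphere_real_apply_univ, finrank_tangentAt q, Nat.cast_sub (by omega), Nat.cast_one]
  rw [hsurface, Measure.real, Measure.addHaar_closedBall _ _ (Real.sqrt_nonneg _),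
    finrank_tangentAt q, sqrt_pow_eq_rpow hd zero_le_two, ENNReal.toReal_mul,
    ENNReal.toReal_ofReal (by positivity), Measure.real]
  field_simp

lemma norm_indicator_distToQuery_le_exp (q x : USphere d) {t : ℝ} (ht : 0 < t) :
    ‖{y | distToQuery q y ≤ t}.indicator (fun _ => (1 : ℝ)) x‖ ≤
      Real.exp 1 * Real.exp (-1 * (t⁻¹ * distToQuery q x)) := by
  rw [norm_indicator_eq_indicator_norm, norm_one]
  refine Set.indicator_apply_le' (fun hx : distToQuery q x ≤ t => ?_) (fun _ => by positivity)
  rw [← Real.exp_add, Real.one_le_exp_iff]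
  have := (inv_mul_le_one₀ ht).2 hx
  linarith

lemma tendsto_indicator_distToQuery_gnomonic (q : USphere d) {v : tangentAt q}
    (hv : ‖v‖ ≠ √2) :
    Tendsto (fun t : ℝ => {y | distToQuery q y ≤ t}.indicator (fun _ => (1 : ℝ))
        (gnomonic q ((√t⁻¹)⁻¹ • v))) (𝓝[>] 0)
      (𝓝 ((closedBall (0 : tangentAt q) √2).indicator (fun _ => 1) v)) := by
  have hlim := tendsto_mul_distToQuery_gnomonic tendsto_inv_nhdsGT_zero q v
  refine tendsto_const_nhds.congr' ?_
  rcases hv.lt_or_gt with hv | hv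
  · have hlt : ‖v‖ ^ 2 / 2 < 1 := by
      linarith [(Real.lt_sqrt (norm_nonneg _)).1 hv]
    filter_upwards [hlim.eventually_lt_const hlt, self_mem_nhdsWithin] with t hdist ht
    rw [Set.indicator_of_mem (mem_closedBall_zero_iff.2 hv.le), Set.indicator_of_mem]
    exact (inv_mul_le_one₀ ht).1 hdist.le
  · have hgt : 1 < ‖v‖ ^ 2 / 2 := by
      linarith [(Real.sqrt_lt' ((Real.sqrt_nonneg 2).trans_lt hv)).1 hv]
    filter_upwards [hlim.eventually_const_lt hgt, self_mem_nhdsWithin] with t hdist ht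
    rw [Set.indicator_of_notMem (fun h => hv.not_ge (mem_closedBall_zero_iff.1 h)),
      Set.indicator_of_notMem]
    exact fun hmem => hdist.not_ge ((inv_mul_le_one₀ ht).2 hmem)

theorem tendsto_densityLaw_distToQuery (hd : 2 ≤ d) (q : USphere d) (hρ : Measurable ρ)
    (hρ0 : ∀ x, 0 ≤ ρ x) [IsFiniteMeasure (densityLaw ρ)] (hρc : ContinuousAt ρ q) :
    Tendsto (fun t : ℝ => (densityLaw ρ).real {y | distToQuery q y ≤ t} *
        t ^ (-(1 / alphaExp d))) (𝓝[>] 0) (𝓝 (localIntensity d (ρ q))) := by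
  have hmeas (t : ℝ) : MeasurableSet {y : USphere d | distToQuery q y ≤ t} :=
    measurableSet_le (continuous_distToQuery q).measurable measurable_const
  have hnull : ∀ᵐ v : tangentAt q, v ∉ sphere 0 √2 :=
    measure_eq_zero_iff_ae_notMem.1
      (Measure.addHaar_sphere_of_ne_zero volume 0 (Real.sqrt_ne_zero'.2 two_pos))
  have hlim := tendsto_integral_densityLaw_localization hd q hρ hρ0 hρc
    tendsto_inv_nhdsGT_zero (fun t => stronglyMeasurable_const.indicator (hmeas t))
    (Real.exp_pos 1).le one_pos
    (eventually_mem_nhdsWithin.mono fun t ht x => norm_indicator_distToQuery_le_exp q x ht)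
    (hnull.mono fun v hv => tendsto_indicator_distToQuery_gnomonic q
      (mt mem_sphere_zero_iff_norm.2 hv))
  rw [integral_indicator measurableSet_closedBall, setIntegral_const, smul_eq_mul, smul_eq_mul,
    mul_one, volume_real_closedBall_sqrt_two hd q, mul_comm, ← localIntensity] at hlim
  refine hlim.congr' (eventually_mem_nhdsWithin.mono fun t (ht : 0 < t) => ?_)
  rw [integral_indicator (hmeas t), setIntegral_const, smul_eq_mul, smul_eq_mul, mul_one,
    Real.inv_rpow ht.le, ← Real.rpow_neg ht.le, mul_comm]

end LocalIntensity

/-! ### Convergence of the softmax ratio -/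

section ConvergenceInDistribution

variable {ι Ω' E : Type*} {Ω : ι → Type*} [∀ i, MeasurableSpace (Ω i)] [MeasurableSpace Ω']
  {μ : ∀ i, Measure (Ω i)} [∀ i, IsProbabilityMeasure (μ i)] {μ' : Measure Ω'}
  [IsProbabilityMeasure μ'] {l : Filter ι} [MeasurableSpace E]

lemma limsup_measure_preimage_le_of_tendstoInDistribution [TopologicalSpace E]
    [HasOuterApproxClosed E] [OpensMeasurableSpace E] {X : ∀ i, Ω i → E} {Z : Ω' → E}
    (h : TendstoInDistribution X l Z μ μ') {A : Set E} (hA : IsClosed A) :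
    limsup (fun i => μ i (X i ⁻¹' A)) l ≤ μ' (Z ⁻¹' A) := by
  have hlimsup := ProbabilityMeasure.limsup_measure_closed_le_of_tendsto h.tendsto hA
  simpa only [ProbabilityMeasure.coe_mk, Measure.map_apply_of_aemeasurable
    (h.forall_aemeasurable _) hA.measurableSet, Measure.map_apply_of_aemeasurable
    h.aemeasurable_limit hA.measurableSet] using hlimsup

theorem tendstoInDistribution_comp_of_ae_continuousAt {F : Type*} [l.IsCountablyGenerated]
    [TopologicalSpace E] [HasOuterApproxClosed E] [OpensMeasurableSpace E]
    [TopologicalSpace F] [HasOuterApproxClosed F] [MeasurableSpace F] [OpensMeasurableSpace F]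
    {X : ∀ i, Ω i → E} {Z : Ω' → E} (h : TendstoInDistribution X l Z μ μ') {g : E → F}
    (hg : Measurable g) (hc : ∀ᵐ ω ∂μ', ContinuousAt g (Z ω)) :
    TendstoInDistribution (fun i ω => g (X i ω)) l (fun ω => g (Z ω)) μ μ' := by
  have hX (i) : AEMeasurable (fun ω => g (X i ω)) (μ i) :=
    hg.comp_aemeasurable (h.forall_aemeasurable i)
  have hZ : AEMeasurable (fun ω => g (Z ω)) μ' := hg.comp_aemeasurable h.aemeasurable_limit
  refine ⟨hX, hZ, tendsto_of_forall_isClosed_limsup_le' fun A hA => ?_⟩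
  simp only [ProbabilityMeasure.coe_mk, Measure.map_apply_of_aemeasurable (hX _) hA.measurableSet,
    Measure.map_apply_of_aemeasurable hZ hA.measurableSet]
  have hclosure : ∀ᵐ ω ∂μ', Z ω ∈ closure (g ⁻¹' A) → g (Z ω) ∈ A := by
    filter_upwards [hc] with ω hω hmem
    exact hA.closure_subset_iff.2 (Set.image_preimage_subset g A)
      (hω.continuousWithinAt.mem_closure_image hmem)
  calc limsup (fun i => μ i ((fun ω => g (X i ω)) ⁻¹' A)) l
      ≤ limsup (fun i => μ i (X i ⁻¹' closure (g ⁻¹' A))) l :=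
        limsup_le_limsup (Eventually.of_forall fun i =>
          measure_mono fun ω hω => subset_closure hω)
    _ ≤ μ' (Z ⁻¹' closure (g ⁻¹' A)) :=
        limsup_measure_preimage_le_of_tendstoInDistribution h isClosed_closure
    _ ≤ μ' ((fun ω => g (Z ω)) ⁻¹' A) := measure_mono_ae hclosure

omit [∀ i, MeasurableSpace (Ω i)] in
theorem tendstoInMeasure_const_of_tendstoInDistribution {Ω : Type*} [MeasurableSpace Ω]
    {P : Measure Ω} [IsProbabilityMeasure P] [PseudoEMetricSpace E] [OpensMeasurableSpace E]
    {X : ι → Ω → E} {a : E}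
    (h : TendstoInDistribution X l (fun _ => a) (fun _ => P) μ') :
    TendstoInMeasure P X l (fun _ => a) := by
  intro ε hε
  have hclosed : IsClosed {y : E | ε ≤ edist y a} := isClosed_le continuous_const (by fun_prop)
  have hlimsup := limsup_measure_preimage_le_of_tendstoInDistribution h hclosed
  rw [Set.preimage_const_of_notMem (by simpa using hε.ne'), measure_empty] at hlimsup
  exact tendsto_of_le_liminf_of_limsup_le bot_le hlimsup

theorem tendstoInMeasure_zero_of_tendstoInDistribution_smul {Ω : Type*} [MeasurableSpace Ω]
    {P : Measure Ω} [IsProbabilityMeasure P] [l.IsCountablyGenerated] [NormedAddCommGroup E]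
    [NormedSpace ℝ E] [SecondCountableTopology E] [BorelSpace E] {Y : ι → Ω → E} {Z : Ω' → E}
    {c : ι → ℝ} (hc : Tendsto c l atTop)
    (h : TendstoInDistribution (fun i ω => c i • Y i ω) l Z (fun _ => P) μ') :
    TendstoInMeasure P Y l (fun _ => 0) := by
  have hinv : TendstoInMeasure P (fun i _ => (c i)⁻¹) l fun _ => (0 : ℝ) := by
    intro ε hε
    refine tendsto_const_nhds.congr' ?_
    filter_upwards [(tendsto_inv_atTop_zero.comp hc).eventually (eball_mem_nhds 0 hε)] with i hi
    have hempty : {_ω : Ω | ε ≤ edist (c i)⁻¹ 0} = ∅ :=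
      Set.eq_empty_of_forall_notMem fun _ => (mem_eball.1 hi).not_ge
    rw [hempty, measure_empty]
  have hslutsky := h.continuous_comp_prodMk_of_tendstoInMeasure_const
    (g := fun p : E × ℝ => p.2 • p.1) (by fun_prop) hinv fun _ => aemeasurable_const
  simp only [zero_smul] at hslutsky
  refine (tendstoInMeasure_const_of_tendstoInDistribution hslutsky).congr' ?_ .rfl
  filter_upwards [hc.eventually_gt_atTop 0] with i hi
  simp [smul_smul, hi.ne']

end ConvergenceInDistribution

section Keys

variable {d : ℕ}

/-- The contribution of a key `x` to the rescaled numerator `∑ⱼ e^{-β Dⱼ} √β (xⱼ - q)` and to the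
denominator `∑ⱼ e^{-β Dⱼ}` of the displacement, where `Dⱼ` is the distance-to-query of `xⱼ`; the
common factor `e^β` of the softmax weights has been cancelled. -/
def keyVector (β : ℝ) (q x : USphere d) : WithLp 2 (EuclideanSpace ℝ (Fin d) × ℝ) :=
  WithLp.toLp 2 (Real.exp (-(β * distToQuery q x)) • √β • ((x : EuclideanSpace ℝ (Fin d)) - q),
    Real.exp (-(β * distToQuery q x)))

lemma continuous_keyVector (β : ℝ) (q : USphere d) : Continuous (keyVector β q) := by
  have := continuous_distToQuery q
  unfold keyVector
  fun_prop

lemma norm_keyVector_sq {β : ℝ} (hβ : 0 ≤ β) (q x : USphere d) :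
    ‖keyVector β q x‖ ^ 2 =
      Real.exp (-(β * distToQuery q x)) ^ 2 * (2 * (β * distToQuery q x) + 1) := by
  rw [WithLp.prod_norm_sq_eq_of_L2, keyVector, WithLp.toLp_fst, WithLp.toLp_snd, norm_smul,
    norm_smul, mul_pow, mul_pow, norm_sub_sq_eq_distToQuery,
    Real.norm_of_nonneg (Real.sqrt_nonneg β), Real.sq_sqrt hβ,
    Real.norm_of_nonneg (Real.exp_pos _).le]
  ring

lemma norm_keyVector_le {β : ℝ} (hβ : 0 ≤ β) (q x : USphere d) :
    ‖keyVector β q x‖ ≤ √2 * Real.exp (-(1 / 2) * (β * distToQuery q x)) := by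
  have hsq (a : ℝ) : Real.exp a = Real.exp (1 / 2 * a) ^ 2 := by
    rw [← Real.exp_nat_mul]
    ring_nf
  refine le_of_sq_le_sq ?_ (by positivity)
  set y := β * distToQuery q x
  calc ‖keyVector β q x‖ ^ 2 = Real.exp (-y) ^ 2 * (2 * y + 1) := norm_keyVector_sq hβ q x
    _ ≤ Real.exp (-y) ^ 2 * (2 * Real.exp y) := by
        gcongr
        linarith [Real.add_one_le_exp y]
    _ = 2 * Real.exp (-y) := by
        rw [sq, mul_assoc, mul_left_comm _ 2, ← Real.exp_add, neg_add_cancel, Real.exp_zero]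
        ring
    _ = (√2 * Real.exp (-(1 / 2) * y)) ^ 2 := by
        rw [mul_pow, Real.sq_sqrt zero_le_two, hsq (-y), mul_neg, neg_mul]

/-- The limit of `keyVector` when the key is at tangential displacement `v / √β` from the query. -/
def tangentVector (q : USphere d) (v : tangentAt q) : WithLp 2 (EuclideanSpace ℝ (Fin d) × ℝ) :=
  WithLp.toLp 2 (Real.exp (-(‖v‖ ^ 2 / 2)) • (v : EuclideanSpace ℝ (Fin d)),
    Real.exp (-(‖v‖ ^ 2 / 2)))

lemma tendsto_keyVector_gnomonic {ι : Type*} {l : Filter ι} {β : ι → ℝ} (hβ : Tendsto β l atTop)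
    (q : USphere d) (v : tangentAt q) :
    Tendsto (fun i => keyVector (β i) q (gnomonic q ((√(β i))⁻¹ • v))) l
      (𝓝 (tangentVector q v)) := by
  have hdenom := (Real.continuous_exp.tendsto _).comp (tendsto_mul_distToQuery_gnomonic hβ q v).neg
  have hnumer := hdenom.smul (tendsto_sqrt_smul_gnomonic_sub hβ q v)
  exact ((WithLp.prod_continuous_toLp 2 _ _).tendsto _).comp (hnumer.prodMk_nhds hdenom)

/-- The integrands `e^{-y} √(2y) θ` and `e^{-y}` of the limiting ratio, as one vector. -/
def criticalVector (q : USphere d) (z : ℝ≥0 × TangentSphere q) :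
    WithLp 2 (EuclideanSpace ℝ (Fin d) × ℝ) :=
  WithLp.toLp 2 (criticalNumer q z, criticalDenom q z)

lemma continuous_criticalVector (q : USphere d) : Continuous (criticalVector q) :=
  (WithLp.prod_continuous_toLp 2 _ _).comp
    ((continuous_criticalNumer q).prodMk (continuous_criticalDenom q))

lemma integrable_criticalVector {q : USphere d} {Λ : Measure (ℝ≥0 × TangentSphere q)}
    (hN : Integrable (criticalNumer q) Λ) (hD : Integrable (criticalDenom q) Λ) :
    Integrable (criticalVector q) Λ :=
  (WithLp.prodContinuousLinearEquiv 2 ℝ _ _).symm.toContinuousLinearMap.integrable_comp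
    (hN.prodMk hD)

lemma criticalVector_tangentPolar (q : USphere d) (v : ({0}ᶜ : Set (tangentAt q))) :
    criticalVector q (tangentPolar v) = tangentVector q v := by
  rw [criticalVector, criticalNumer_tangentPolar, criticalDenom_tangentPolar, tangentVector]

end Keys

section CriticalRegime

variable {d : ℕ} {β : ℕ → ℝ} {γ : ℝ}

lemma tendsto_atTop_of_tendsto_mul_rpow (hd : 2 ≤ d) (hγ : 0 < γ)
    (hβ : Tendsto (fun n : ℕ => β n * (n : ℝ) ^ (-alphaExp d)) atTop (𝓝 γ)) :
    Tendsto β atTop atTop := by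
  have hrpow : Tendsto (fun n : ℕ => (n : ℝ) ^ alphaExp d) atTop atTop :=
    (tendsto_rpow_atTop (alphaExp_pos hd)).comp tendsto_natCast_atTop_atTop
  refine (hβ.pos_mul_atTop hγ hrpow).congr' ?_
  filter_upwards [eventually_gt_atTop 0] with n hn
  have hn' : (0 : ℝ) < n := by exact_mod_cast hn
  rw [mul_assoc, ← Real.rpow_add hn', neg_add_cancel, Real.rpow_zero, mul_one]

lemma tendsto_natCast_div_rpow (hd : 2 ≤ d) (hγ : 0 < γ)
    (hβ : Tendsto (fun n : ℕ => β n * (n : ℝ) ^ (-alphaExp d)) atTop (𝓝 γ)) :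
    Tendsto (fun n : ℕ => (n : ℝ) / β n ^ (1 / alphaExp d)) atTop
      (𝓝 (γ ^ (-(1 / alphaExp d)))) := by
  refine (hβ.rpow_const (p := -(1 / alphaExp d)) (Or.inl hγ.ne')).congr' ?_
  filter_upwards [(tendsto_atTop_of_tendsto_mul_rpow hd hγ hβ).eventually_ge_atTop 0] with n hb
  rw [Real.mul_rpow hb (by positivity), ← Real.rpow_mul n.cast_nonneg, Real.rpow_neg hb,
    neg_mul_neg, mul_one_div_cancel (alphaExp_pos hd).ne', Real.rpow_one, mul_comm,
    ← div_eq_mul_inv]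

theorem tendsto_natCast_mul_integral_keyVector (hd : 2 ≤ d) (q : USphere d) {ρ : USphere d → ℝ}
    (hρ : Measurable ρ) (hρ0 : ∀ x, 0 ≤ ρ x) [IsFiniteMeasure (densityLaw ρ)]
    (hρc : ContinuousAt ρ q) (hγ : 0 < γ)
    (hβ : Tendsto (fun n : ℕ => β n * (n : ℝ) ^ (-alphaExp d)) atTop (𝓝 γ))
    (t : WithLp 2 (EuclideanSpace ℝ (Fin d) × ℝ)) :
    Tendsto (fun n : ℕ => (n : ℂ) * ∫ x, (Complex.exp (⟪keyVector (β n) q x, t⟫ * Complex.I) - 1)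
        ∂(densityLaw ρ)) atTop
      (𝓝 (∫ z, (Complex.exp (⟪criticalVector q z, t⟫ * Complex.I) - 1)
        ∂(criticalIntensity q γ (ρ q)))) := by
  have hβ' := tendsto_atTop_of_tendsto_mul_rpow hd hγ hβ
  let φ (u : WithLp 2 (EuclideanSpace ℝ (Fin d) × ℝ)) : ℂ :=
    Complex.exp (⟪u, t⟫ * Complex.I) - 1
  have hφ : Continuous φ := by fun_prop
  have hφ_le (u) : ‖φ u‖ ≤ ‖u‖ * ‖t‖ := by
    have hexp : ‖φ u‖ ≤ ‖⟪u, t⟫‖ := by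
      simpa [φ, enorm_le_iff_norm_le] using enorm_exp_mul_I_sub_exp_mul_I_le ⟪u, t⟫ 0
    exact hexp.trans (abs_real_inner_le_norm u t)
  have hlocal := tendsto_integral_densityLaw_localization hd q hρ hρ0 hρc hβ'
    (g := fun n x => φ (keyVector (β n) q x)) (C := √2 * ‖t‖) (c := 1 / 2)
    (fun n => (hφ.comp (continuous_keyVector (β n) q)).stronglyMeasurable) (by positivity)
    (by norm_num) ((hβ'.eventually_ge_atTop 0).mono fun n hn x => by
      grw [hφ_le, norm_keyVector_le hn, mul_right_comm])
    (ae_of_all _ fun v => (hφ.tendsto _).comp (tendsto_keyVector_gnomonic hβ' q v))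
  have hlim := (tendsto_natCast_div_rpow hd hγ hβ).smul hlocal
  rw [smul_smul, ← integral_criticalIntensity hd q hγ (hρ0 q)
    (H := fun z => φ (criticalVector q z))
    (hφ.comp (continuous_criticalVector q)).stronglyMeasurable
    fun v => congrArg φ (criticalVector_tangentPolar q v)] at hlim
  refine hlim.congr' ?_
  filter_upwards [hβ'.eventually_gt_atTop 0] with n hn
  rw [smul_smul, div_mul_cancel₀ _ (Real.rpow_pos_of_pos hn _).ne', Complex.real_smul,
    Complex.ofReal_natCast]

end CriticalRegime

section CriticalRatio

variable {d : ℕ} {Ω : Type*} [MeasurableSpace Ω] {P : Measure Ω} {q : USphere d}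

lemma integral_criticalVector {μ : Measure (ℝ≥0 × TangentSphere q)}
    (hN : Integrable (criticalNumer q) μ) (hD : Integrable (criticalDenom q) μ) :
    ∫ z, criticalVector q z ∂μ =
      WithLp.toLp 2 (∫ z, criticalNumer q z ∂μ, ∫ z, criticalDenom q z ∂μ) := by
  rw [← integral_pair hN hD]
  exact (WithLp.prodContinuousLinearEquiv 2 ℝ _ _).symm.toContinuousLinearMap.integral_comp_comm
    (hN.prodMk hD)

lemma IsPoissonPointProcess.ae_integrable_critical (hd : 2 ≤ d) {γ r : ℝ} (hγ : 0 < γ)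
    (hr : 0 < r) {M : Ω → Measure (ℝ≥0 × TangentSphere q)}
    (hM : IsPoissonPointProcess P (criticalIntensity q γ r) M) :
    ∀ᵐ ω ∂P, Integrable (criticalNumer q) (M ω) ∧ Integrable (criticalDenom q) (M ω) ∧
      0 < ∫ z, criticalDenom q z ∂(M ω) := by
  have := sigmaFinite_criticalIntensity hd q hγ hr.le
  filter_upwards [hM.ae_integrable (continuous_criticalNumer q).stronglyMeasurable
      (integrable_criticalNumer hd q hγ hr.le),
    hM.ae_integrable (continuous_criticalDenom q).stronglyMeasurable
      (integrable_criticalDenom hd q hγ hr.le),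
    hM.ae_ne_zero (criticalIntensity_univ hd q hγ hr)] with ω hN hD hω
  have : NeZero (M ω) := ⟨hω⟩
  exact ⟨hN, hD, integral_exp_pos hD⟩

/-- The ratio of the components of a numerator-denominator pair, transformed by the value matrix;
it takes the sum of the `keyVector`s to the rescaled displacement and the integral of
`criticalVector` to the limit. -/
def valueRatio (V : Matrix (Fin d) (Fin d) ℝ) (z : WithLp 2 (EuclideanSpace ℝ (Fin d) × ℝ)) :
    EuclideanSpace ℝ (Fin d) :=
  V.toEuclideanLin (z.snd⁻¹ • z.fst)

lemma measurable_valueRatio (V : Matrix (Fin d) (Fin d) ℝ) : Measurable (valueRatio V) := by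
  have hfst : Measurable fun z : WithLp 2 (EuclideanSpace ℝ (Fin d) × ℝ) => z.fst :=
    Continuous.measurable (by fun_prop)
  have hsnd : Measurable fun z : WithLp 2 (EuclideanSpace ℝ (Fin d) × ℝ) => z.snd :=
    Continuous.measurable (by fun_prop)
  exact V.toEuclideanLin.continuous_of_finiteDimensional.measurable.comp (hsnd.inv.smul hfst)

lemma continuousAt_valueRatio (V : Matrix (Fin d) (Fin d) ℝ)
    {z : WithLp 2 (EuclideanSpace ℝ (Fin d) × ℝ)} (hz : z.snd ≠ 0) :
    ContinuousAt (valueRatio V) z := by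
  have hsnd : Continuous fun z : WithLp 2 (EuclideanSpace ℝ (Fin d) × ℝ) => z.snd := by fun_prop
  exact V.toEuclideanLin.continuous_of_finiteDimensional.continuousAt.comp
    ((hsnd.continuousAt.inv₀ hz).smul (by fun_prop))

lemma valueRatio_integral_criticalVector (V : Matrix (Fin d) (Fin d) ℝ)
    {μ : Measure (ℝ≥0 × TangentSphere q)} (hN : Integrable (criticalNumer q) μ)
    (hD : Integrable (criticalDenom q) μ) :
    valueRatio V (∫ z, criticalVector q z ∂μ) = V.toEuclideanLin (criticalRatio q μ) := by
  rw [integral_criticalVector hN hD, valueRatio, criticalRatio, WithLp.toLp_fst, WithLp.toLp_snd]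

end CriticalRatio

section Attention

variable {d n : ℕ}

lemma attnWeight_eq (β : ℝ) (q : USphere d) (x : Fin n → USphere d) (j : Fin n) :
    attnWeight β q x j = (∑ l, Real.exp (-(β * distToQuery q (x l))))⁻¹ *
      Real.exp (-(β * distToQuery q (x j))) := by
  have hexp (l : Fin n) : Real.exp (-(β * distToQuery q (x l))) = Real.exp (-β) *
      Real.exp (β * ⟪(q : EuclideanSpace ℝ (Fin d)), (x l : EuclideanSpace ℝ (Fin d))⟫) := by
    rw [← Real.exp_add, distToQuery]
    ring_nf
  simp_rw [hexp]
  rw [← Finset.mul_sum, attnWeight, mul_inv, mul_mul_mul_comm, inv_mul_cancel₀ (Real.exp_ne_zero _),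
    one_mul, div_eq_inv_mul]

lemma sum_attnWeight (hn : n ≠ 0) (β : ℝ) (q : USphere d) (x : Fin n → USphere d) :
    ∑ j, attnWeight β q x j = 1 := by
  have : NeZero n := ⟨hn⟩
  simp_rw [attnWeight, ← Finset.sum_div]
  exact div_self (Finset.sum_pos (fun l _ => Real.exp_pos _) Finset.univ_nonempty).ne'

lemma attnDisplacement_eq (hn : n ≠ 0) (V : Matrix (Fin d) (Fin d) ℝ) (β : ℝ) (q : USphere d)
    (x : Fin n → USphere d) :
    attnDisplacement V β q x =
      V.toEuclideanLin (∑ j, attnWeight β q x j • ((x j : EuclideanSpace ℝ (Fin d)) - q)) := by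
  simp_rw [smul_sub, Finset.sum_sub_distrib, ← Finset.sum_smul]
  rw [sum_attnWeight hn, one_smul, map_sub, attnDisplacement, attnOutput]

lemma sqrt_smul_attnDisplacement_eq (hn : n ≠ 0) (V : Matrix (Fin d) (Fin d) ℝ) (β : ℝ)
    (q : USphere d) (x : Fin n → USphere d) :
    √β • attnDisplacement V β q x = valueRatio V (∑ i, keyVector β q (x i)) := by
  have hfst : (∑ i, keyVector β q (x i)).fst =
      ∑ i, Real.exp (-(β * distToQuery q (x i))) • √β • ((x i : EuclideanSpace ℝ (Fin d)) - q) :=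
    map_sum (WithLp.fstₗ 2 ℝ (EuclideanSpace ℝ (Fin d)) ℝ) _ _
  have hsnd : (∑ i, keyVector β q (x i)).snd = ∑ i, Real.exp (-(β * distToQuery q (x i))) :=
    map_sum (WithLp.sndₗ 2 ℝ (EuclideanSpace ℝ (Fin d)) ℝ) _ _
  rw [valueRatio, hfst, hsnd, attnDisplacement_eq hn, ← map_smul, Finset.smul_sum, Finset.smul_sum]
  simp_rw [attnWeight_eq, mul_smul, smul_comm (√β)]

lemma continuous_attnDisplacement (V : Matrix (Fin d) (Fin d) ℝ) (β : ℝ) (q : USphere d) :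
    Continuous (attnDisplacement (n := n) V β q) := by
  have hweight (j : Fin n) : Continuous fun x : Fin n → USphere d => attnWeight β q x j := by
    refine Continuous.div (by fun_prop) (by fun_prop) fun x => ?_
    exact (Finset.sum_pos (fun l _ => Real.exp_pos _) ⟨j, Finset.mem_univ j⟩).ne'
  have hV := V.toEuclideanLin.continuous_of_finiteDimensional
  exact (hV.comp (by fun_prop)).sub continuous_const

lemma tendstoInMeasure_attnOutput_iff {Ω ι : Type*} [MeasurableSpace Ω] {P : Measure Ω}
    {l : Filter ι} {V : Matrix (Fin d) (Fin d) ℝ} {q : USphere d} {n : ι → ℕ} {β : ι → ℝ}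
    {x : (i : ι) → Fin (n i) → Ω → USphere d} :
    TendstoInMeasure P (fun i ω => attnOutput V (β i) q (fun j => x i j ω)) l
        (fun _ => V.toEuclideanLin (q : EuclideanSpace ℝ (Fin d))) ↔
      TendstoInMeasure P (fun i ω => attnDisplacement V (β i) q (fun j => x i j ω)) l
        (fun _ => 0) := by
  simp only [TendstoInMeasure, attnDisplacement, edist_eq_enorm_sub, sub_zero]

end Attention

section CriticalLimit

variable {d : ℕ} {Ω Ω' : Type*} [MeasurableSpace Ω] [MeasurableSpace Ω'] {P : Measure Ω}
  {ρ : USphere d → ℝ}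

lemma charFun_map_sum_keyVector [IsProbabilityMeasure (densityLaw ρ)] {n : ℕ}
    {x : Fin n → Ω → USphere d} (hlaw : ∀ i, HasLaw (x i) (densityLaw ρ) P)
    (hindep : iIndepFun x P) (β : ℝ) (q : USphere d)
    (t : WithLp 2 (EuclideanSpace ℝ (Fin d) × ℝ)) :
    charFun (P.map fun ω => ∑ i, keyVector β q (x i ω)) t =
      (1 + ∫ y, (Complex.exp (⟪keyVector β q y, t⟫ * Complex.I) - 1) ∂(densityLaw ρ)) ^ n := by
  have hkey := continuous_keyVector β q
  have hmeas (i : Fin n) : AEMeasurable (fun ω => keyVector β q (x i ω)) P :=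
    hkey.measurable.comp_aemeasurable (hlaw i).aemeasurable
  have hcomp : iIndepFun (fun i ω => keyVector β q (x i ω)) P :=
    hindep.comp (fun _ => keyVector β q) fun _ => hkey.measurable
  have hint : Integrable (fun y => Complex.exp (⟪keyVector β q y, t⟫ * Complex.I))
      (densityLaw ρ) :=
    integrable_exp_mul_I (Continuous.aestronglyMeasurable (by fun_prop))
  have hone (i : Fin n) : charFun (P.map fun ω => keyVector β q (x i ω)) t =
      1 + ∫ y, (Complex.exp (⟪keyVector β q y, t⟫ * Complex.I) - 1) ∂(densityLaw ρ) := by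
    rw [integral_sub hint (integrable_const _), integral_const, probReal_univ, one_smul,
      add_sub_cancel, charFun_apply, integral_map (hmeas i) (by fun_prop)]
    exact (hlaw i).integral_comp hint.1
  rw [hcomp.charFun_map_fun_sum_eq_prod hmeas, Finset.prod_apply]
  simp_rw [hone, Finset.prod_const, Finset.card_fin]

variable [IsProbabilityMeasure P] {q : USphere d} {x : (n : ℕ) → Fin n → Ω → USphere d}
  {β : ℕ → ℝ} {γ : ℝ}

theorem tendstoInDistribution_sum_keyVector (hd : 2 ≤ d) (hρ : Measurable ρ) (hρ0 : ∀ x, 0 ≤ ρ x)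
    (hρc : ContinuousAt ρ q) (hlaw : ∀ n i, HasLaw (x n i) (densityLaw ρ) P)
    (hindep : ∀ n, iIndepFun (x n) P) (hγ : 0 < γ)
    (hβ : Tendsto (fun n : ℕ => β n * (n : ℝ) ^ (-alphaExp d)) atTop (𝓝 γ))
    {P' : Measure Ω'} [IsProbabilityMeasure P'] {M : Ω' → Measure (ℝ≥0 × TangentSphere q)}
    (hM : IsPoissonPointProcess P' (criticalIntensity q γ (ρ q)) M) :
    TendstoInDistribution (fun n ω => ∑ i, keyVector (β n) q (x n i ω)) atTop
      (fun ω => ∫ z, criticalVector q z ∂(M ω)) (fun _ => P) P' := by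
  have : IsProbabilityMeasure (densityLaw ρ) := (hlaw 1 0).isProbabilityMeasure_iff.1 inferInstance
  have := sigmaFinite_criticalIntensity hd q hγ (hρ0 q)
  have hcritical := (continuous_criticalVector q).stronglyMeasurable
  refine ⟨fun n => Finset.aemeasurable_fun_sum _ fun i _ =>
      (continuous_keyVector (β n) q).measurable.comp_aemeasurable (hlaw n i).aemeasurable,
    (hM.stronglyMeasurable_integral hcritical).measurable.aemeasurable, ?_⟩
  refine ProbabilityMeasure.tendsto_of_tendsto_charFun fun t => ?_
  simp only [ProbabilityMeasure.coe_mk, charFun_map_sum_keyVector (hlaw _) (hindep _)]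
  rw [hM.charFun_map_integral hcritical (integrable_criticalVector
    (integrable_criticalNumer hd q hγ (hρ0 q)) (integrable_criticalDenom hd q hγ (hρ0 q)))]
  exact Complex.tendsto_one_add_pow_exp_of_tendsto
    (tendsto_natCast_mul_integral_keyVector hd q hρ hρ0 hρc hγ hβ t)

variable (V : Matrix (Fin d) (Fin d) ℝ)

theorem tendstoInDistribution_attnDisplacement (hd : 2 ≤ d) (hρ : Measurable ρ)
    (hρ0 : ∀ x, 0 ≤ ρ x) (hρc : ContinuousAt ρ q) (hρq : 0 < ρ q)
    (hlaw : ∀ n i, HasLaw (x n i) (densityLaw ρ) P) (hindep : ∀ n, iIndepFun (x n) P) (hγ : 0 < γ)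
    (hβ : Tendsto (fun n : ℕ => β n * (n : ℝ) ^ (-alphaExp d)) atTop (𝓝 γ))
    {P' : Measure Ω'} [IsProbabilityMeasure P'] {M : Ω' → Measure (ℝ≥0 × TangentSphere q)}
    (hM : IsPoissonPointProcess P' (criticalIntensity q γ (ρ q)) M) :
    TendstoInDistribution
      (fun (n : ℕ) (ω : Ω) => √(β n) • attnDisplacement V (β n) q (fun i => x n i ω)) atTop
      (fun ω => V.toEuclideanLin (criticalRatio q (M ω))) (fun _ => P) P' := by
  have hae := hM.ae_integrable_critical hd hγ hρq
  have hratio := tendstoInDistribution_comp_of_ae_continuousAt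
    (tendstoInDistribution_sum_keyVector hd hρ hρ0 hρc hlaw hindep hγ hβ hM)
    (measurable_valueRatio V) (by
      filter_upwards [hae] with ω ⟨hN, hD, hpos⟩
      rw [integral_criticalVector hN hD]
      exact continuousAt_valueRatio V hpos.ne')
  have hlimit := hratio.congr (fun _ => .rfl) (hae.mono fun ω hω =>
    valueRatio_integral_criticalVector V hω.1 hω.2.1)
  refine ⟨fun n => ?_, hlimit.aemeasurable_limit, hlimit.tendsto.congr' ?_⟩
  · exact ((continuous_attnDisplacement V (β n) q).measurable.comp_aemeasurable
      (aemeasurable_pi_lambda _ fun i => (hlaw n i).aemeasurable)).const_smul (√(β n))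
  · filter_upwards [eventually_ne_atTop 0] with n hn
    exact Subtype.ext (by simp_rw [sqrt_smul_attnDisplacement_eq hn])

theorem tendstoInMeasure_attnDisplacement (hd : 2 ≤ d) (hρ : Measurable ρ)
    (hρ0 : ∀ x, 0 ≤ ρ x) (hρc : ContinuousAt ρ q) (hρq : 0 < ρ q)
    (hlaw : ∀ n i, HasLaw (x n i) (densityLaw ρ) P) (hindep : ∀ n, iIndepFun (x n) P) (hγ : 0 < γ)
    (hβ : Tendsto (fun n : ℕ => β n * (n : ℝ) ^ (-alphaExp d)) atTop (𝓝 γ)) :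
    TendstoInMeasure P (fun (n : ℕ) (ω : Ω) => attnDisplacement V (β n) q (fun i => x n i ω))
      atTop (fun _ => 0) := by
  obtain ⟨Ω₀, _, P₀, _, M, hM⟩ := exists_poissonPointProcess_criticalIntensity hd q hγ (hρ0 q)
  exact tendstoInMeasure_zero_of_tendstoInDistribution_smul
    (Real.tendsto_sqrt_atTop.comp (tendsto_atTop_of_tendsto_mul_rpow hd hγ hβ))
    (tendstoInDistribution_attnDisplacement V hd hρ hρ0 hρc hρq hlaw hindep hγ hβ hM)

end CriticalLimit

theorem theorem4p2_general {Ω Ω' : Type*} [MeasurableSpace Ω] [MeasurableSpace Ω']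
    (d : ℕ) (hd : 2 ≤ d) (q : USphere d) (V : Matrix (Fin d) (Fin d) ℝ)
    (ρ : USphere d → ℝ) (hρ : Measurable ρ) (hρc : ContinuousAt ρ q) (hρ0 : ∀ x, 0 ≤ ρ x)
    (hρq : 0 < ρ q)
    (P : Measure Ω) [IsProbabilityMeasure P]
    (x : (n : ℕ) → Fin n → Ω → USphere d)
    (hlaw : ∀ n i, HasLaw (x n i) (densityLaw ρ) P)
    (hindep : ∀ n, iIndepFun (x n) P)
    (β : ℕ → ℝ) (γ : ℝ) (hγ : 0 < γ)
    (hβ : Tendsto (fun n : ℕ => β n * (n : ℝ) ^ (-alphaExp d)) atTop (𝓝 γ)) :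
    Tendsto (fun t : ℝ => (densityLaw ρ).real {y | distToQuery q y ≤ t} *
        t ^ (-(1 / alphaExp d))) (𝓝[>] 0) (𝓝 (localIntensity d (ρ q))) ∧
    (∃ (Ω₀ : Type) (_ : MeasurableSpace Ω₀) (P₀ : Measure Ω₀) (_ : IsProbabilityMeasure P₀)
        (M : Ω₀ → Measure (ℝ≥0 × TangentSphere q)),
        IsPoissonPointProcess P₀ (criticalIntensity q γ (ρ q)) M) ∧
    (∀ (P' : Measure Ω') [IsProbabilityMeasure P'] (M : Ω' → Measure (ℝ≥0 × TangentSphere q)),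
        IsPoissonPointProcess P' (criticalIntensity q γ (ρ q)) M →
        (∀ᵐ ω ∂P', Integrable (criticalNumer q) (M ω) ∧ Integrable (criticalDenom q) (M ω) ∧
          0 < ∫ z, criticalDenom q z ∂(M ω)) ∧
        TendstoInDistribution
          (fun (n : ℕ) (ω : Ω) => √(β n) • attnDisplacement V (β n) q (fun i => x n i ω)) atTop
          (fun ω => V.toEuclideanLin (criticalRatio q (M ω))) (fun _ => P) P') ∧
    TendstoInMeasure P (fun (n : ℕ) (ω : Ω) => attnDisplacement V (β n) q (fun i => x n i ω))
      atTop (fun _ => 0) ∧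
    TendstoInMeasure P (fun (n : ℕ) (ω : Ω) => attnOutput V (β n) q (fun i => x n i ω))
      atTop (fun _ => V.toEuclideanLin (q : EuclideanSpace ℝ (Fin d))) := by
  have : IsProbabilityMeasure (densityLaw ρ) := (hlaw 1 0).isProbabilityMeasure_iff.1 inferInstance
  have hdisp := tendstoInMeasure_attnDisplacement V hd hρ hρ0 hρc hρq hlaw hindep hγ hβ
  exact ⟨tendsto_densityLaw_distToQuery hd q hρ hρ0 hρc,
    exists_poissonPointProcess_criticalIntensity hd q hγ (hρ0 q),
    fun P' _ M hM => ⟨hM.ae_integrable_critical hd hγ hρq,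
      tendstoInDistribution_attnDisplacement V hd hρ hρ0 hρc hρq hlaw hindep hγ hβ hM⟩,
    hdisp, tendstoInMeasure_attnOutput_iff.2 hdisp⟩

lemma IsC2OnSphere.continuous {d : ℕ} {hd : 2 ≤ d} {ρ : USphere d → ℝ}
    (hρ : IsC2OnSphere d hd ρ) : Continuous ρ := by
  have : Fact (Module.finrank ℝ (EuclideanSpace ℝ (Fin d)) = (d - 1) + 1) :=
    ⟨by rw [finrank_euclideanSpace_fin]; omega⟩
  exact ContMDiff.continuous (show ContMDiff (𝓡 (d - 1)) 𝓘(ℝ, ℝ) 2 ρ from hρ)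

end

theorem theorem4p2 {Ω Ω' : Type*} [MeasurableSpace Ω] [MeasurableSpace Ω']
    (d : ℕ) (hd : 2 ≤ d) (q : USphere d) (V : Matrix (Fin d) (Fin d) ℝ)
    (ρ : USphere d → ℝ) (hρC2 : IsC2OnSphere d hd ρ) (hρ0 : ∀ x, 0 ≤ ρ x) (hρq : 0 < ρ q)
    (P : Measure Ω) [IsProbabilityMeasure P]
    (x : (n : ℕ) → Fin n → Ω → USphere d)
    (hlaw : ∀ n i, HasLaw (x n i) (densityLaw ρ) P)
    (hindep : ∀ n, iIndepFun (x n) P)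
    (β : ℕ → ℝ) (γ : ℝ) (hγ : 0 < γ)
    (hβ : Tendsto (fun n : ℕ => β n * (n : ℝ) ^ (-alphaExp d)) atTop (𝓝 γ)) :
    -- the local intensity is the limit of `F(t) t^{-1/α}`, `F` the distribution function of the
    -- distance-to-query of a key
    Tendsto (fun t : ℝ => (densityLaw ρ).real {y | distToQuery q y ≤ t} *
        t ^ (-(1 / alphaExp d))) (𝓝[>] 0) (𝓝 (localIntensity d (ρ q))) ∧
    -- the Poisson process exists
    (∃ (Ω₀ : Type) (_ : MeasurableSpace Ω₀) (P₀ : Measure Ω₀) (_ : IsProbabilityMeasure P₀)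
        (M : Ω₀ → Measure (ℝ≥0 × TangentSphere q)),
        IsPoissonPointProcess P₀ (criticalIntensity q γ (ρ q)) M) ∧
    -- for every such process the ratio is well defined and gives the limit law
    (∀ (P' : Measure Ω') [IsProbabilityMeasure P'] (M : Ω' → Measure (ℝ≥0 × TangentSphere q)),
        IsPoissonPointProcess P' (criticalIntensity q γ (ρ q)) M →
        (∀ᵐ ω ∂P', Integrable (criticalNumer q) (M ω) ∧ Integrable (criticalDenom q) (M ω) ∧
          0 < ∫ z, criticalDenom q z ∂(M ω)) ∧
        TendstoInDistribution
          (fun (n : ℕ) (ω : Ω) => √(β n) • attnDisplacement V (β n) q (fun i => x n i ω)) atTop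
          (fun ω => V.toEuclideanLin (criticalRatio q (M ω))) (fun _ => P) P') ∧
    -- convergence in probability of the displacement and of the output
    TendstoInMeasure P (fun (n : ℕ) (ω : Ω) => attnDisplacement V (β n) q (fun i => x n i ω))
      atTop (fun _ => 0) ∧
    TendstoInMeasure P (fun (n : ℕ) (ω : Ω) => attnOutput V (β n) q (fun i => x n i ω))
      atTop (fun _ => V.toEuclideanLin (q : EuclideanSpace ℝ (Fin d))) :=
  theorem4p2_general d hd q V ρ hρC2.continuous.measurable hρC2.continuous.continuousAt hρ0 hρq P x
    hlaw hindep β γ hγ hβ
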